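/- **Proposition 2.9 (strict convexity of small geodesic spheres).** Let $M$ be a (Hausdorff) $C^\infty$ manifold of dimension $n$ and let $F:TM\to\mathbb R$ be a Finsler metric: $F$ is continuous on $TM$, $C^\infty$ off the zero section, positively homogeneous of degree one on the fibres ($F(x,rX)=rF(x,X)$ for $r\ge 0$), positive on non-zero vectors, and the matrices $g_{ij}(x,X)=\frac12\frac{\partial^2F^2}{\partial X^i\partial X^j}(x,X)$, $X\neq0$, are positive definite. Geodesics are the $C^2$ solutions of the Euler–Lagrange equations of $\frac12F^2$ (they have constant speed $F(c,\dot c)$), and $\mathrm{Exp}_x(X)=c_X(1)$, where $c_X$ is the geodesic with $c_X(0)=x$, $\dot c_X(0)=X$. Let $\partial B_\varepsilon(x)=\mathrm{Exp}_x(\{X\in T_xM: F(x,X)=\varepsilon\})$, and let $d(x,y)$ be the Finslerian distance, i.e. the infimum of the lengths $\int_0^1 F(\gamma,\dot\gamma)\,dt$ of the $C^1$ curves $\gamma:[0,1]\to M$ from $x$ to $y$. For every $x\in M$ and every $\eta>0$ there is $\varepsilon_0\in(0,\eta)$ such that for all $\varepsilon\in(0,\varepsilon_0)$ and all $\mu\in(0,1)$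 there is $\rho=\rho(\mu,\varepsilon)>0$ with the following property. Let $c:[0,a]\to M$, $a>0$, be a non-constant geodesic, let $t_0\in(0,a)$ be such that $c(t_0)\in\partial B_\varepsilon(x)$ and $\dot c(t_0)$ is tangent to $\partial B_\varepsilon(x)$, and put $v=F(c(t_0),\dot c(t_0))$. Then $$d(x,c(t))\;\ge\; d(x,c(t_0))+\mu\,v^2(t-t_0)^2\qquad\text{for all } t\in[0,a]\text{ with } v\,|t-t_0|\le\rho .$$ In particular, if $c$ is parametrized by arc length, then $d(x,c(t))\ge d(x,c(t_0))+\mu(t-t_0)^2$ for all $t\in[0,a]$ with $|t-t_0|\le\rho$. -/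

import Mathlib

open Set Filter Topology
open scoped Manifold ContDiff

noncomputable section

namespace Finsler

variable {n : ℕ} {M : Type*} [TopologicalSpace M] [ChartedSpace (EuclideanSpace ℝ (Fin n)) M]

/-- The fundamental tensor `g_{(x,X)}(u, w) = (1/2) ∂²F²/∂Xⁱ∂Xʲ (x,X) uⁱ wʲ` of a function `F` on the
tangent bundle: half of the second derivative of `F²` along the fibre `T_x M` (a copy of `ℝⁿ`). -/
def fundamentalTensor (F : TangentBundle (𝓡 n) M → ℝ) (x : M)
    (X u w : EuclideanSpace ℝ (Fin n)) : ℝ :=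
  (1 / 2) * iteratedFDeriv ℝ 2
    (fun Z : EuclideanSpace ℝ (Fin n) => F ⟨x, Z⟩ ^ 2) X ![u, w]

/-- `F : TM → ℝ` is a Finsler metric on the manifold `M`. Only positive homogeneity is required:
`F` need not be reversible. -/
structure IsFinslerMetric [IsManifold (𝓡 n) ∞ M] (F : TangentBundle (𝓡 n) M → ℝ) : Prop where
  continuous : Continuous F
  smooth : ContMDiffOn (𝓡 n).tangent 𝓘(ℝ, ℝ) ∞ F {v | v.2 ≠ 0}
  homogeneous : ∀ (x : M) (X : TangentSpace (𝓡 n) x) (r : ℝ), 0 ≤ r →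
    F ⟨x, r • X⟩ = r * F ⟨x, X⟩
  pos : ∀ (x : M) (X : TangentSpace (𝓡 n) x), X ≠ 0 → 0 < F ⟨x, X⟩
  posDef : ∀ (x : M) (X u : EuclideanSpace ℝ (Fin n)), X ≠ 0 → u ≠ 0 →
    0 < fundamentalTensor F x X u u

/-- The velocity `ċ(t)`, as a point of the tangent bundle, of a curve `c` defined on the
set `s` of times (one-sided at the endpoints if `s` is a closed interval). -/
def velocity (c : ℝ → M) (s : Set ℝ) (t : ℝ) : TangentBundle (𝓡 n) M :=
  ⟨c t, mfderivWithin 𝓘(ℝ, ℝ) (𝓡 n) c s t (1 : ℝ)⟩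

/-- The Lagrangian `F² / 2` read in the chart `e`, as a function of the coordinates `p` of the point
and the components `w` of the tangent vector. -/
def chartLagrangian (F : TangentBundle (𝓡 n) M → ℝ)
    (e : OpenPartialHomeomorph M (EuclideanSpace ℝ (Fin n)))
    (p w : EuclideanSpace ℝ (Fin n)) : ℝ :=
  (1 / 2) * F ⟨e.symm p, mfderiv (𝓡 n) (𝓡 n) e.symm p w⟩ ^ 2

/-- `c` is a geodesic of `F` on the interval `s`: a curve of class `C²` which in every chart satisfies
the Euler-Lagrange equations `d/dt (∂L/∂Xⁱ) = ∂L/∂xⁱ` of `L = F² / 2`. Constant curves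
are geodesics, and geodesics have constant speed. -/
def IsGeodesicOn (F : TangentBundle (𝓡 n) M → ℝ) (c : ℝ → M) (s : Set ℝ) : Prop :=
  ContMDiffOn 𝓘(ℝ, ℝ) (𝓡 n) 2 c s ∧
  ∀ e ∈ atlas (EuclideanSpace ℝ (Fin n)) M, ∀ t ∈ s, c t ∈ e.source →
    HasDerivWithinAt
      (fun τ => fderiv ℝ (fun w => chartLagrangian F e (e (c τ)) w) (derivWithin (e ∘ c) s τ))
      (fderiv ℝ (fun p => chartLagrangian F e p (derivWithin (e ∘ c) s t)) (e (c t)))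
      s t

/-- `y = Exp_x(X)`: there is a geodesic `c` on `[0,1]` with `c(0) = x`, `ċ(0) = X` and `c(1) = y`. -/
def IsExp (F : TangentBundle (𝓡 n) M → ℝ) (x : M) (X : TangentSpace (𝓡 n) x) (y : M) : Prop :=
  ∃ c : ℝ → M, IsGeodesicOn F c (Icc 0 1) ∧
    velocity c (Icc 0 1) 0 = (⟨x, X⟩ : TangentBundle (𝓡 n) M) ∧ c 1 = y

/-- The geodesic sphere `∂B_ε(x) = Exp_x({X ∈ T_x M : F(x,X) = ε})`. -/
def geodesicSphere (F : TangentBundle (𝓡 n) M → ℝ) (x : M) (ε : ℝ) : Set M :=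
  {y | ∃ X : TangentSpace (𝓡 n) x, F ⟨x, X⟩ = ε ∧ IsExp F x X y}

/-- The vector `v` is tangent to the set `S` at its base point: it is the velocity at time `0` of
a `C¹` curve running in `S`. For a submanifold `S` this says `v ∈ TS`. -/
def IsTangentTo (S : Set M) (v : TangentBundle (𝓡 n) M) : Prop :=
  ∃ σ : ℝ → M, ContMDiffAt 𝓘(ℝ, ℝ) (𝓡 n) 1 σ 0 ∧ (∀ᶠ r in 𝓝 (0 : ℝ), σ r ∈ S) ∧
    velocity σ univ 0 = v

/-- The Finslerian length of a curve `γ` defined on `[0,1]`. -/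
def length (F : TangentBundle (𝓡 n) M → ℝ) (γ : ℝ → M) : ℝ :=
  ∫ t in (0 : ℝ)..1, F (velocity γ (Icc 0 1) t)

/-- The Finslerian distance from `x` to `y`: the infimum of the lengths of the `C¹` curves from `x` to
`y`. It is only used for points of the same connected component. -/
def finslerDist (F : TangentBundle (𝓡 n) M → ℝ) (x y : M) : ℝ :=
  sInf {l | ∃ γ : ℝ → M, ContMDiffOn 𝓘(ℝ, ℝ) (𝓡 n) 1 γ (Icc 0 1) ∧ γ 0 = x ∧ γ 1 = y ∧
    l = length F γ}

end Finsler

end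

/-! Everything takes place in one chart around x, with the Lagrangian L = F²/2. Over a compact
coordinate ball, homogeneity and compactness of the unit sphere give constants `lam` and `K`: L is
uniformly convex in the velocity, and its first derivatives are controlled with the correct power of
the velocity. Neither a normal neighbourhood nor a smooth distance function is used.

The core is a calibration inequality, `HasLagrangianBounds.energy_comparison`, which becomes
`IsControlledChart.length_comparison` on the manifold. Let γ be a radial geodesic of small speed ε
on [0,1] and p its momentum ∂L/∂w at time 1. Every C¹ curve α from x of length ℓ ≤ 2ε satisfies, in
coordinates, ε²/2 + p(ξ) + (lam/16)‖ξ‖² ≤ ℓ²/2, where ξ = α(1) − γ(1). Thus half the squared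
distance to x is supported from below at γ(1) by a function with affine part ε²/2 + p and a positive
quadratic part. The coefficient lam/16 does not depend on ε.

Applied to the radial geodesics ending on a curve in the sphere, the inequality shows that p has a
local maximum along that curve, so p annihilates tangent vectors
(`IsControlledChart.momentum_tangent_eq_zero`, which plays the part of the Gauss lemma). Let c be a
geodesic tangent to the sphere, and let s = v|t − t₀|. By `IsControlledChart.geodesic_expansion`,
the displacement ξ of c differs from its tangent vector by O(s²). Since p vanishes on the tangent
vector and ‖p‖ = O(ε), p(ξ) is at least −O(ε)s², while ‖ξ‖² is at least a constant times s². Hence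
ℓ² ≥ ε² + κs² with κ independent of ε. For 2ε + s² ≤ κ this gives ℓ ≥ ε + s², which suffices for
every μ ≤ 1. -/

namespace Finsler

/-! ### Homogeneous Lagrangians on a vector space: partial derivatives and scaling. -/

/-- A function `L p w`, smooth off `w = 0`, homogeneous of degree two in `w` and with positive definite
Hessian in `w`, for base points `p` in an open set `U`. -/
structure IsSmoothLagrangian {E : Type*} [NormedAddCommGroup E] [NormedSpace ℝ E]
    (L : E → E → ℝ) (U : Set E) : Prop where
  isOpen : IsOpen U
  smooth : ContDiffOn ℝ ∞ (fun z : E × E => L z.1 z.2) (U ×ˢ {0}ᶜ)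
  homogeneous : ∀ p ∈ U, ∀ (w : E) (r : ℝ), 0 ≤ r → L p (r • w) = r ^ 2 * L p w
  posDef : ∀ p ∈ U, ∀ w u : E, w ≠ 0 → u ≠ 0 → 0 < fderiv ℝ (fderiv ℝ (L p)) w u u

/-- Uniform quantitative convexity and regularity of a Lagrangian over a set `B` of base points. -/
structure HasLagrangianBounds {E : Type*} [NormedAddCommGroup E] [NormedSpace ℝ E]
    (L : E → E → ℝ) (B : Set E) (lam K : ℝ) : Prop where
  lam_pos : 0 < lam
  const_pos : 0 < K
  eq_zero : ∀ p ∈ B, L p 0 = 0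
  upper : ∀ p ∈ B, ∀ w, L p w ≤ K * ‖w‖ ^ 2
  convex : ∀ p ∈ B, ∀ w w',
    L p w + fderiv ℝ (L p) w (w' - w) + lam * ‖w' - w‖ ^ 2 ≤ L p w'
  taylor : ∀ p ∈ B, ∀ q ∈ B, ∀ w,
    L p w + fderiv ℝ (fun p => L p w) p (q - p) - K * ‖w‖ ^ 2 * ‖q - p‖ ^ 2 ≤ L q w
  base_lip : ∀ p ∈ B, ∀ w w',
    ‖fderiv ℝ (fun p => L p w') p - fderiv ℝ (fun p => L p w) p‖ ≤ K * (‖w‖ + ‖w'‖) * ‖w' - w‖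
  fiber_lip : ∀ p ∈ B, ∀ q ∈ B, ∀ w,
    ‖fderiv ℝ (L q) w - fderiv ℝ (L p) w‖ ≤ K * ‖w‖ * ‖q - p‖
  fiber_bound : ∀ p ∈ B, ∀ w, ‖fderiv ℝ (L p) w‖ ≤ K * ‖w‖
  base_bound : ∀ p ∈ B, ∀ w, ‖fderiv ℝ (fun p => L p w) p‖ ≤ K * ‖w‖ ^ 2

namespace IsSmoothLagrangian

variable {E : Type*} [NormedAddCommGroup E] [NormedSpace ℝ E] {L : E → E → ℝ} {U : Set E}

theorem isOpen_domain (h : IsSmoothLagrangian L U) : IsOpen (U ×ˢ ({0}ᶜ : Set E)) :=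
  h.isOpen.prod isOpen_compl_singleton

theorem eq_zero (h : IsSmoothLagrangian L U) {p : E} (hp : p ∈ U) : L p 0 = 0 := by
  simpa using h.homogeneous p hp 0 0 le_rfl

theorem hasFDerivAt (h : IsSmoothLagrangian L U) {z : E × E} (hz : z ∈ U ×ˢ ({0}ᶜ : Set E)) :
    HasFDerivAt (fun z : E × E => L z.1 z.2) (fderiv ℝ (fun z : E × E => L z.1 z.2) z) z :=
  ((h.smooth.contDiffAt (h.isOpen_domain.mem_nhds hz)).differentiableAt (by simp)).hasFDerivAt

theorem contDiffOn_fderiv (h : IsSmoothLagrangian L U) :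
    ContDiffOn ℝ ∞ (fderiv ℝ (fun z : E × E => L z.1 z.2)) (U ×ˢ ({0}ᶜ : Set E)) :=
  h.smooth.fderiv_of_isOpen h.isOpen_domain (by simp)

theorem contDiffOn_fderiv_fderiv (h : IsSmoothLagrangian L U) :
    ContDiffOn ℝ ∞ (fderiv ℝ (fderiv ℝ (fun z : E × E => L z.1 z.2))) (U ×ˢ ({0}ᶜ : Set E)) :=
  h.contDiffOn_fderiv.fderiv_of_isOpen h.isOpen_domain (by simp)

theorem hasFDerivAt_fderiv (h : IsSmoothLagrangian L U) {z : E × E}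
    (hz : z ∈ U ×ˢ ({0}ᶜ : Set E)) :
    HasFDerivAt (fderiv ℝ (fun z : E × E => L z.1 z.2))
      (fderiv ℝ (fderiv ℝ (fun z : E × E => L z.1 z.2)) z) z :=
  ((h.contDiffOn_fderiv.contDiffAt (h.isOpen_domain.mem_nhds hz)).differentiableAt
    (by simp)).hasFDerivAt

theorem hasFDerivAt_base (h : IsSmoothLagrangian L U) {p w : E} (hp : p ∈ U) (hw : w ≠ 0) :
    HasFDerivAt (fun p => L p w) ((fderiv ℝ (fun z : E × E => L z.1 z.2) (p, w)).comp
      (ContinuousLinearMap.inl ℝ E E)) p :=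
  HasFDerivAt.comp (f := fun p => (p, w)) p (h.hasFDerivAt (z := (p, w)) ⟨hp, hw⟩)
    (hasFDerivAt_prodMk_left p w)

theorem hasFDerivAt_fiber (h : IsSmoothLagrangian L U) {p w : E} (hp : p ∈ U) (hw : w ≠ 0) :
    HasFDerivAt (L p) ((fderiv ℝ (fun z : E × E => L z.1 z.2) (p, w)).comp
      (ContinuousLinearMap.inr ℝ E E)) w :=
  HasFDerivAt.comp (f := fun w => (p, w)) w (h.hasFDerivAt (z := (p, w)) ⟨hp, hw⟩)
    (hasFDerivAt_prodMk_right p w)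

/-- Composition on the right with a fixed linear map, as a continuous linear map. -/
noncomputable abbrev rightComp {V W : Type*} [NormedAddCommGroup V] [NormedSpace ℝ V]
    [NormedAddCommGroup W] [NormedSpace ℝ W] (j : W →L[ℝ] V) : (V →L[ℝ] ℝ) →L[ℝ] (W →L[ℝ] ℝ) :=
  (ContinuousLinearMap.compL ℝ W V ℝ).flip j

/-- This and the next three lemmas identify the second partial derivatives with blocks of the second
derivative of the joint function, so that one compactness argument bounds them all. -/
theorem hasFDerivAt_base_fderiv_fiber (h : IsSmoothLagrangian L U) {p w : E} (hp : p ∈ U)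
    (hw : w ≠ 0) :
    HasFDerivAt (fun p => fderiv ℝ (L p) w)
      ((rightComp (ContinuousLinearMap.inr ℝ E E)).comp
        ((fderiv ℝ (fderiv ℝ (fun z : E × E => L z.1 z.2)) (p, w)).comp
          (ContinuousLinearMap.inl ℝ E E))) p := by
  have h1 := HasFDerivAt.comp (f := fun p => (p, w)) p
    (h.hasFDerivAt_fderiv (z := (p, w)) ⟨hp, hw⟩) (hasFDerivAt_prodMk_left p w)
  have h2 := (rightComp (ContinuousLinearMap.inr ℝ E E)).hasFDerivAt.comp p h1
  refine h2.congr_of_eventuallyEq ?_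
  filter_upwards [h.isOpen.mem_nhds hp] with q hq
  exact (h.hasFDerivAt_fiber hq hw).fderiv

theorem hasFDerivAt_fiber_fderiv_fiber (h : IsSmoothLagrangian L U) {p w : E} (hp : p ∈ U)
    (hw : w ≠ 0) :
    HasFDerivAt (fderiv ℝ (L p))
      ((rightComp (ContinuousLinearMap.inr ℝ E E)).comp
        ((fderiv ℝ (fderiv ℝ (fun z : E × E => L z.1 z.2)) (p, w)).comp
          (ContinuousLinearMap.inr ℝ E E))) w := by
  have h1 := HasFDerivAt.comp (f := fun w => (p, w)) w
    (h.hasFDerivAt_fderiv (z := (p, w)) ⟨hp, hw⟩) (hasFDerivAt_prodMk_right p w)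
  have h2 := (rightComp (ContinuousLinearMap.inr ℝ E E)).hasFDerivAt.comp w h1
  refine h2.congr_of_eventuallyEq ?_
  filter_upwards [isOpen_compl_singleton.mem_nhds hw] with q hq
  exact (h.hasFDerivAt_fiber hp hq).fderiv

theorem hasFDerivAt_base_fderiv_base (h : IsSmoothLagrangian L U) {p w : E} (hp : p ∈ U)
    (hw : w ≠ 0) :
    HasFDerivAt (fun p => fderiv ℝ (fun p => L p w) p)
      ((rightComp (ContinuousLinearMap.inl ℝ E E)).comp
        ((fderiv ℝ (fderiv ℝ (fun z : E × E => L z.1 z.2)) (p, w)).comp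
          (ContinuousLinearMap.inl ℝ E E))) p := by
  have h1 := HasFDerivAt.comp (f := fun p => (p, w)) p
    (h.hasFDerivAt_fderiv (z := (p, w)) ⟨hp, hw⟩) (hasFDerivAt_prodMk_left p w)
  have h2 := (rightComp (ContinuousLinearMap.inl ℝ E E)).hasFDerivAt.comp p h1
  refine h2.congr_of_eventuallyEq ?_
  filter_upwards [h.isOpen.mem_nhds hp] with q hq
  exact (h.hasFDerivAt_base hq hw).fderiv

theorem hasFDerivAt_fiber_fderiv_base (h : IsSmoothLagrangian L U) {p w : E} (hp : p ∈ U)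
    (hw : w ≠ 0) :
    HasFDerivAt (fun w => fderiv ℝ (fun p => L p w) p)
      ((rightComp (ContinuousLinearMap.inl ℝ E E)).comp
        ((fderiv ℝ (fderiv ℝ (fun z : E × E => L z.1 z.2)) (p, w)).comp
          (ContinuousLinearMap.inr ℝ E E))) w := by
  have h1 := HasFDerivAt.comp (f := fun w => (p, w)) w
    (h.hasFDerivAt_fderiv (z := (p, w)) ⟨hp, hw⟩) (hasFDerivAt_prodMk_right p w)
  have h2 := (rightComp (ContinuousLinearMap.inl ℝ E E)).hasFDerivAt.comp w h1
  refine h2.congr_of_eventuallyEq ?_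
  filter_upwards [isOpen_compl_singleton.mem_nhds hw] with q hq
  exact (h.hasFDerivAt_base hp hq).fderiv

/-- The dilation of the fibres by the factor `r`. -/
noncomputable abbrev fiberDilation (E : Type*) [NormedAddCommGroup E] [NormedSpace ℝ E] (r : ℝ) :
    E × E →L[ℝ] E × E :=
  (ContinuousLinearMap.fst ℝ E E).prod (r • ContinuousLinearMap.snd ℝ E E)

/-- Differentiating the relation L(p, rw) = r²L(p, w) in (p, w). With the second-order version
below, it carries bounds from unit vectors to all non-zero vectors. -/
theorem fderiv_dilation (h : IsSmoothLagrangian L U) {z : E × E} (hz : z ∈ U ×ˢ ({0}ᶜ : Set E))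
    {r : ℝ} (hr : 0 < r) :
    (fderiv ℝ (fun z : E × E => L z.1 z.2) (fiberDilation E r z)).comp (fiberDilation E r)
      = r ^ 2 • fderiv ℝ (fun z : E × E => L z.1 z.2) z := by
  have hz' : fiberDilation E r z ∈ U ×ˢ ({0}ᶜ : Set E) :=
    ⟨hz.1, smul_ne_zero hr.ne' hz.2⟩
  have h1 := (h.hasFDerivAt hz').comp z (fiberDilation E r).hasFDerivAt
  have h2 := (h.hasFDerivAt hz).const_smul (r ^ 2)
  refine h1.unique (h2.congr_of_eventuallyEq ?_)
  filter_upwards [h.isOpen_domain.mem_nhds hz] with y hy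
  exact h.homogeneous y.1 hy.1 y.2 r hr.le

theorem fderiv_fderiv_dilation (h : IsSmoothLagrangian L U) {z : E × E}
    (hz : z ∈ U ×ˢ ({0}ᶜ : Set E)) {r : ℝ} (hr : 0 < r) (a b : E × E) :
    fderiv ℝ (fderiv ℝ (fun z : E × E => L z.1 z.2)) (fiberDilation E r z)
        (fiberDilation E r a) (fiberDilation E r b)
      = r ^ 2 * fderiv ℝ (fderiv ℝ (fun z : E × E => L z.1 z.2)) z a b := by
  have hz' : fiberDilation E r z ∈ U ×ˢ ({0}ᶜ : Set E) :=
    ⟨hz.1, smul_ne_zero hr.ne' hz.2⟩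
  have h1 := (rightComp (fiberDilation E r)).hasFDerivAt.comp z
    ((h.hasFDerivAt_fderiv hz').comp z (fiberDilation E r).hasFDerivAt)
  have h2 := (h.hasFDerivAt_fderiv hz).const_smul (r ^ 2)
  have h3 := h1.unique (h2.congr_of_eventuallyEq (by
    filter_upwards [h.isOpen_domain.mem_nhds hz] with y hy
    exact h.fderiv_dilation hy hr))
  have h4 := congrArg (fun A : E × E →L[ℝ] E × E →L[ℝ] ℝ => A a b) h3
  simpa using h4

theorem hess_fiber (h : IsSmoothLagrangian L U) {p w : E} (hp : p ∈ U) (hw : w ≠ 0) (u : E) :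
    fderiv ℝ (fderiv ℝ (L p)) w u u
      = fderiv ℝ (fderiv ℝ (fun z : E × E => L z.1 z.2)) (p, w) (0, u) (0, u) := by
  rw [(h.hasFDerivAt_fiber_fderiv_fiber hp hw).fderiv]
  simp

/-- The derivatives up to order two over a compact set of base points, controlled by homogeneity. -/
theorem exists_bounds [FiniteDimensional ℝ E] (h : IsSmoothLagrangian L U) {B : Set E}
    (hB : IsCompact B) (hBU : B ⊆ U) :
    ∃ lam K : ℝ, 0 < lam ∧ 0 < K ∧ ∀ p ∈ B, ∀ w : E, w ≠ 0 →
      (|L p w| ≤ K * ‖w‖ ^ 2) ∧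
      (∀ ξ η : E, ‖fderiv ℝ (fun z : E × E => L z.1 z.2) (p, w) (ξ, η)‖
        ≤ K * ‖w‖ ^ 2 * (‖ξ‖ + ‖η‖ / ‖w‖)) ∧
      (∀ ξ η ξ' η' : E, ‖fderiv ℝ (fderiv ℝ (fun z : E × E => L z.1 z.2)) (p, w) (ξ, η) (ξ', η')‖
        ≤ K * ‖w‖ ^ 2 * (‖ξ‖ + ‖η‖ / ‖w‖) * (‖ξ'‖ + ‖η'‖ / ‖w‖)) ∧
      (∀ u : E, 2 * lam * ‖u‖ ^ 2 ≤
        fderiv ℝ (fderiv ℝ (fun z : E × E => L z.1 z.2)) (p, w) (0, u) (0, u)) := by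
  have : ProperSpace E := FiniteDimensional.proper ℝ E
  set Λ : E × E → ℝ := fun z => L z.1 z.2 with hΛ
  have hC : IsCompact (B ×ˢ Metric.sphere (0 : E) 1) := hB.prod (isCompact_sphere _ _)
  have hCZ : B ×ˢ Metric.sphere (0 : E) 1 ⊆ U ×ˢ ({0}ᶜ : Set E) := by
    rintro ⟨p, w⟩ ⟨hp, hw⟩
    refine ⟨hBU hp, ?_⟩
    rintro rfl
    simp at hw
  obtain ⟨K0, hK0⟩ := hC.exists_bound_of_continuousOn (h.smooth.continuousOn.mono hCZ)
  obtain ⟨K1, hK1⟩ := hC.exists_bound_of_continuousOn (h.contDiffOn_fderiv.continuousOn.mono hCZ)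
  obtain ⟨K2, hK2⟩ := hC.exists_bound_of_continuousOn (f := fderiv ℝ (fderiv ℝ Λ))
    (h.contDiffOn_fderiv_fderiv.continuousOn.mono hCZ)
  -- The fibre Hessian is continuous and positive on a compact set of triples (p, w, u), so it has a
  -- positive minimum; the set may be empty, and then any constant will do.
  obtain ⟨lam, hlam, hlam'⟩ : ∃ lam : ℝ, 0 < lam ∧ ∀ p ∈ B, ∀ w ∈ Metric.sphere (0 : E) 1,
      ∀ u ∈ Metric.sphere (0 : E) 1, lam ≤ fderiv ℝ (fderiv ℝ Λ) (p, w) (0, u) (0, u) := by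
    have hC' : IsCompact ((B ×ˢ Metric.sphere (0 : E) 1) ×ˢ Metric.sphere (0 : E) 1) :=
      hC.prod (isCompact_sphere _ _)
    rcases Set.eq_empty_or_nonempty
      ((B ×ˢ Metric.sphere (0 : E) 1) ×ˢ Metric.sphere (0 : E) 1) with he | hne
    · refine ⟨1, one_pos, fun p hp w hw u hu => ?_⟩
      have : ((p, w), u) ∈ (B ×ˢ Metric.sphere (0 : E) 1) ×ˢ Metric.sphere (0 : E) 1 :=
        ⟨⟨hp, hw⟩, hu⟩
      rw [he] at this
      exact this.elim
    · have hcont : ContinuousOn (fun y : (E × E) × E => fderiv ℝ (fderiv ℝ Λ) y.1 (0, y.2) (0, y.2))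
          ((B ×ˢ Metric.sphere (0 : E) 1) ×ˢ Metric.sphere (0 : E) 1) := by
        have h1 : ContinuousOn (fun y : (E × E) × E => fderiv ℝ (fderiv ℝ Λ) y.1)
            ((B ×ˢ Metric.sphere (0 : E) 1) ×ˢ Metric.sphere (0 : E) 1) :=
          (h.contDiffOn_fderiv_fderiv.continuousOn.mono hCZ).comp continuousOn_fst
            (fun y hy => hy.1)
        have h2 : Continuous (fun y : (E × E) × E => ((0 : E), y.2)) := by fun_prop
        exact (h1.clm_apply h2.continuousOn).clm_apply h2.continuousOn
      obtain ⟨⟨⟨p, w⟩, u⟩, ⟨⟨hp, hw⟩, hu⟩, hmin⟩ := hC'.exists_isMinOn hne hcont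
      have hw0 : w ≠ 0 := by rintro rfl; simp at hw
      have hu0 : u ≠ 0 := by rintro rfl; simp at hu
      refine ⟨fderiv ℝ (fderiv ℝ Λ) (p, w) (0, u) (0, u), ?_, fun p' hp' w' hw' u' hu' => ?_⟩
      · rw [← h.hess_fiber (hBU hp) hw0]
        exact h.posDef p (hBU hp) w u hw0 hu0
      · exact hmin (show ((p', w'), u') ∈ _ from ⟨⟨hp', hw'⟩, hu'⟩)
  set K := |K0| + |K1| + |K2| + 1 with hK
  have hKpos : 0 < K := by positivity
  refine ⟨lam / 2, K, by positivity, hKpos, fun p hp w hw => ?_⟩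
  have hr : 0 < ‖w‖ := norm_pos_iff.2 hw
  set w0 := ‖w‖⁻¹ • w with hw0
  have hw0s : w0 ∈ Metric.sphere (0 : E) 1 := by
    simp [hw0, norm_smul, inv_mul_cancel₀ hr.ne']
  have hmem : (p, w0) ∈ B ×ˢ Metric.sphere (0 : E) 1 := ⟨hp, hw0s⟩
  have hz := hCZ hmem
  -- A vector with fibre component η at w is the dilation of one with component η/‖w‖ at w/‖w‖. This
  -- is the source of the weights ‖ξ‖ + ‖η‖/‖w‖.
  have hdil : fiberDilation E ‖w‖ (p, w0) = (p, w) := by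
    simp [hw0, smul_smul, mul_inv_cancel₀ hr.ne']
  have hdil' : ∀ ξ η : E, fiberDilation E ‖w‖ (ξ, ‖w‖⁻¹ • η) = (ξ, η) := by
    intro ξ η
    simp [smul_smul, mul_inv_cancel₀ hr.ne']
  have hnorm : ∀ ξ η : E, ‖(ξ, ‖w‖⁻¹ • η)‖ ≤ ‖ξ‖ + ‖η‖ / ‖w‖ := by
    intro ξ η
    rw [Prod.norm_mk, norm_smul, norm_inv, norm_norm, inv_mul_eq_div]
    exact max_le_add_of_nonneg (norm_nonneg _) (by positivity)
  refine ⟨?_, fun ξ η => ?_, fun ξ η ξ' η' => ?_, fun u => ?_⟩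
  · have e1 : L p w = ‖w‖ ^ 2 * L p w0 := by
      rw [← h.homogeneous p (hBU hp) w0 _ hr.le, hw0, smul_smul, mul_inv_cancel₀ hr.ne', one_smul]
    have e2 : |L p w0| ≤ K := by
      have := hK0 _ hmem
      simp only [Real.norm_eq_abs] at this
      have := le_abs_self K0
      have := abs_nonneg K1
      have := abs_nonneg K2
      linarith
    rw [e1, abs_mul, abs_of_nonneg (sq_nonneg _), mul_comm K]
    gcongr
  · have e1 := congrArg (fun A : E × E →L[ℝ] ℝ => A (ξ, ‖w‖⁻¹ • η)) (h.fderiv_dilation hz hr)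
    simp only [ContinuousLinearMap.comp_apply, hdil, hdil', _root_.smul_apply,
      smul_eq_mul] at e1
    rw [e1, norm_mul, Real.norm_eq_abs, abs_of_nonneg (sq_nonneg _)]
    have e2 : ‖fderiv ℝ Λ (p, w0)‖ ≤ K := by
      have := hK1 _ hmem
      have := le_abs_self K1
      have := abs_nonneg K0
      have := abs_nonneg K2
      linarith
    have e3 := (fderiv ℝ Λ (p, w0)).le_opNorm (ξ, ‖w‖⁻¹ • η)
    calc _ ≤ ‖w‖ ^ 2 * (K * (‖ξ‖ + ‖η‖ / ‖w‖)) := by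
            gcongr
            exact e3.trans (mul_le_mul e2 (hnorm ξ η) (norm_nonneg _) hKpos.le)
      _ = _ := by ring
  · have e1 := h.fderiv_fderiv_dilation hz hr (ξ, ‖w‖⁻¹ • η) (ξ', ‖w‖⁻¹ • η')
    rw [hdil, hdil', hdil'] at e1
    rw [e1, norm_mul, Real.norm_eq_abs, abs_of_nonneg (sq_nonneg _)]
    have e2 : ‖fderiv ℝ (fderiv ℝ Λ) (p, w0)‖ ≤ K := by
      have := hK2 _ hmem
      have := le_abs_self K2
      have := abs_nonneg K0
      have := abs_nonneg K1
      linarith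
    have e3 := (fderiv ℝ (fderiv ℝ Λ) (p, w0)).le_opNorm₂ (ξ, ‖w‖⁻¹ • η) (ξ', ‖w‖⁻¹ • η')
    calc _ ≤ ‖w‖ ^ 2 * (K * (‖ξ‖ + ‖η‖ / ‖w‖) * (‖ξ'‖ + ‖η'‖ / ‖w‖)) := by
            gcongr
            refine e3.trans ?_
            gcongr
            · exact hnorm ξ η
            · exact hnorm ξ' η'
      _ = _ := by ring
  · rcases eq_or_ne u 0 with rfl | hu
    · have : ((0 : E), (0 : E)) = 0 := rfl
      simp [this]
    have hu' : 0 < ‖u‖ := norm_pos_iff.2 hu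
    have e1 := h.fderiv_fderiv_dilation hz hr (0, ‖w‖⁻¹ • u) (0, ‖w‖⁻¹ • u)
    rw [hdil, hdil'] at e1
    have e2 := hlam' p hp w0 hw0s (‖u‖⁻¹ • u) (by simp [norm_smul, inv_mul_cancel₀ hu'.ne'])
    have e3 : ((0 : E), ‖w‖⁻¹ • u) = (‖u‖ / ‖w‖) • ((0 : E), ‖u‖⁻¹ • u) := by
      ext
      · simp
      · simp only [Prod.smul_mk, smul_smul]
        congr 1
        field_simp
    rw [e1, e3]
    simp only [map_smul, _root_.smul_apply, smul_eq_mul]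
    calc _ = ‖u‖ ^ 2 * lam := by ring
      _ ≤ ‖u‖ ^ 2 * fderiv ℝ (fderiv ℝ Λ) (p, w0) (0, ‖u‖⁻¹ • u) (0, ‖u‖⁻¹ • u) := by gcongr
      _ = _ := by simp only [hΛ]; field_simp

end IsSmoothLagrangian

end Finsler

/-! ### Uniform convexity and Lipschitz bounds, including at zero velocity. -/

namespace Finsler

/-- Second-order lower bound for a function on `[0,1]` whose second derivative is bounded below. -/
theorem taylor_lower_bound {h h' h'' : ℝ → ℝ} {C : ℝ} (hh : ∀ s ∈ Icc (0 : ℝ) 1, HasDerivAt h (h' s) s)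
    (hh' : ∀ s ∈ Icc (0 : ℝ) 1, HasDerivAt h' (h'' s) s) (hC : ∀ s ∈ Icc (0 : ℝ) 1, 2 * C ≤ h'' s) :
    h 0 + h' 0 + C ≤ h 1 := by
  have hmono' : MonotoneOn (fun s => h' s - 2 * C * s) (Icc 0 1) := by
    have hd : ∀ s ∈ Icc (0 : ℝ) 1, HasDerivAt (fun s => h' s - 2 * C * s) (h'' s - 2 * C) s := by
      intro s hs
      simpa using (hh' s hs).fun_sub ((hasDerivAt_id' s).const_mul (2 * C))
    refine monotoneOn_of_hasDerivWithinAt_nonneg (convex_Icc 0 1)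
      (f' := fun s => h'' s - 2 * C)
      (fun s hs => (hd s hs).continuousAt.continuousWithinAt)
      (fun s hs => (hd s (interior_subset hs)).hasDerivWithinAt) (fun s hs => ?_)
    linarith [hC s (interior_subset hs)]
  have hmono : MonotoneOn (fun s => h s - h' 0 * s - C * s ^ 2) (Icc 0 1) := by
    have hd : ∀ s ∈ Icc (0 : ℝ) 1,
        HasDerivAt (fun s => h s - h' 0 * s - C * s ^ 2) (h' s - h' 0 - 2 * C * s) s := by
      intro s hs
      refine (((hh s hs).fun_sub ((hasDerivAt_id' s).const_mul (h' 0))).fun_sub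
        ((hasDerivAt_pow 2 s).const_mul C)).congr_deriv ?_
      norm_num
      ring
    refine monotoneOn_of_hasDerivWithinAt_nonneg (convex_Icc 0 1)
      (f' := fun s => h' s - h' 0 - 2 * C * s)
      (fun s hs => (hd s hs).continuousAt.continuousWithinAt)
      (fun s hs => (hd s (interior_subset hs)).hasDerivWithinAt) (fun s hs => ?_)
    have hs' := interior_subset hs
    have := hmono' (left_mem_Icc.2 zero_le_one) hs' hs'.1
    simp only [mul_zero, sub_zero] at this
    linarith
  have := hmono (left_mem_Icc.2 zero_le_one) (right_mem_Icc.2 zero_le_one) zero_le_one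
  simp only at this
  linarith

namespace IsSmoothLagrangian

variable {E : Type*} [NormedAddCommGroup E] [NormedSpace ℝ E] {L : E → E → ℝ} {U : Set E}

/-- Euler's identity for the homogeneous function `L p`. -/
theorem fderiv_fiber_self (h : IsSmoothLagrangian L U) {p w : E} (hp : p ∈ U) (hw : w ≠ 0) :
    fderiv ℝ (L p) w w = 2 * L p w := by
  have h1 : HasDerivAt (fun r : ℝ => L p (r • w)) (fderiv ℝ (L p) w w) 1 := by
    have hc : HasDerivAt (fun r : ℝ => r • w) w 1 := by
      simpa using (hasDerivAt_id (1 : ℝ)).smul_const w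
    have hf : HasFDerivAt (L p) (fderiv ℝ (L p) w) ((1 : ℝ) • w) := by
      rw [one_smul]
      exact (h.hasFDerivAt_fiber hp hw).differentiableAt.hasFDerivAt
    exact hf.comp_hasDerivAt 1 hc
  have h2 : HasDerivAt (fun r : ℝ => L p (r • w)) (2 * L p w) 1 := by
    have := (hasDerivAt_pow 2 (1 : ℝ)).mul_const (L p w)
    norm_num at this
    refine this.congr_of_eventuallyEq ?_
    filter_upwards [lt_mem_nhds (zero_lt_one' ℝ)] with r hr
    exact h.homogeneous p hp w r hr.le
  exact h1.unique h2

/-- Euler's identity differentiated along the ray through w. It converts the lower bound for the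
Hessian into a lower bound for L itself. -/
theorem hess_fiber_self (h : IsSmoothLagrangian L U) {p w : E} (hp : p ∈ U) (hw : w ≠ 0) :
    fderiv ℝ (fderiv ℝ (L p)) w w w = 2 * L p w := by
  have h1 : HasDerivAt (fun r : ℝ => fderiv ℝ (L p) (r • w) w)
      (fderiv ℝ (fderiv ℝ (L p)) w w w) 1 := by
    have hc : HasDerivAt (fun r : ℝ => r • w) w 1 := by
      simpa using (hasDerivAt_id (1 : ℝ)).smul_const w
    have hf : HasFDerivAt (fderiv ℝ (L p)) (fderiv ℝ (fderiv ℝ (L p)) w) ((1 : ℝ) • w) := by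
      rw [one_smul]
      exact (h.hasFDerivAt_fiber_fderiv_fiber hp hw).differentiableAt.hasFDerivAt
    have h0 : HasDerivAt (fun r : ℝ => fderiv ℝ (L p) (r • w)) (fderiv ℝ (fderiv ℝ (L p)) w w) 1 :=
      hf.comp_hasDerivAt 1 hc
    simpa using h0.clm_apply (hasDerivAt_const (1 : ℝ) w)
  have h2 : HasDerivAt (fun r : ℝ => fderiv ℝ (L p) (r • w) w) (2 * L p w) 1 := by
    have := (hasDerivAt_id (1 : ℝ)).mul_const (2 * L p w)
    simp only [one_mul] at this
    refine this.congr_of_eventuallyEq ?_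
    filter_upwards [lt_mem_nhds (zero_lt_one' ℝ)] with r hr
    have e := h.fderiv_fiber_self hp (smul_ne_zero hr.ne' hw)
    rw [map_smul, h.homogeneous p hp w r hr.le, smul_eq_mul] at e
    simp only [id]
    have : r * (fderiv ℝ (L p) (r • w) w - r * (2 * L p w)) = 0 := by linarith
    rcases mul_eq_zero.1 this with h0 | h0
    · exact absurd h0 hr.ne'
    · linarith
  exact h1.unique h2

/-- Away from w = 0 these are Taylor and mean value estimates from `exists_bounds`. L need not be C²
at w = 0; there the quadratic decay of L and of its base derivative gives the derivatives needed. -/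
theorem exists_hasLagrangianBounds [FiniteDimensional ℝ E] (h : IsSmoothLagrangian L U)
    {B : Set E} (hB : IsCompact B) (hBc : Convex ℝ B) (hBU : B ⊆ U) :
    ∃ lam K : ℝ, HasLagrangianBounds L B lam K := by
  obtain ⟨lam, K, hlam, hK, hb⟩ := h.exists_bounds hB hBU
  have hupper : ∀ p ∈ B, ∀ w, |L p w| ≤ K * ‖w‖ ^ 2 := by
    intro p hp w
    rcases eq_or_ne w 0 with rfl | hw
    · simp [h.eq_zero (hBU hp)]
    · exact (hb p hp w hw).1
  have hfib0 : ∀ p ∈ B, HasFDerivAt (L p) (0 : E →L[ℝ] ℝ) 0 := by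
    intro p hp
    refine Asymptotics.IsBigO.hasFDerivAt (n := 2) ?_ one_lt_two
    refine Asymptotics.IsBigO.of_bound K (Eventually.of_forall fun w => ?_)
    simpa using hupper p hp w
  have hbase0 : ∀ p ∈ B, HasFDerivAt (fun p => L p 0) (0 : E →L[ℝ] ℝ) p := by
    intro p hp
    refine (hasFDerivAt_const (0 : ℝ) p).congr_of_eventuallyEq ?_
    filter_upwards [h.isOpen.mem_nhds (hBU hp)] with q hq
    exact h.eq_zero hq
  have hbase_bound : ∀ p ∈ B, ∀ w, ‖fderiv ℝ (fun p => L p w) p‖ ≤ K * ‖w‖ ^ 2 := by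
    intro p hp w
    rcases eq_or_ne w 0 with rfl | hw
    · simp [(hbase0 p hp).fderiv]
    rw [(h.hasFDerivAt_base (hBU hp) hw).fderiv]
    refine ContinuousLinearMap.opNorm_le_bound _ (by positivity) fun ξ => ?_
    simpa using (hb p hp w hw).2.1 ξ 0
  have hfiber_bound : ∀ p ∈ B, ∀ w, ‖fderiv ℝ (L p) w‖ ≤ K * ‖w‖ := by
    intro p hp w
    rcases eq_or_ne w 0 with rfl | hw
    · simp [(hfib0 p hp).fderiv]
    rw [(h.hasFDerivAt_fiber (hBU hp) hw).fderiv]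
    have hw' : 0 < ‖w‖ := norm_pos_iff.2 hw
    refine ContinuousLinearMap.opNorm_le_bound _ (by positivity) fun ξ => ?_
    have := (hb p hp w hw).2.1 0 ξ
    rw [norm_zero, zero_add] at this
    refine this.trans_eq ?_
    field_simp
  have hlower : ∀ p ∈ B, ∀ w, lam * ‖w‖ ^ 2 ≤ L p w := by
    intro p hp w
    rcases eq_or_ne w 0 with rfl | hw
    · simp [h.eq_zero (hBU hp)]
    have e1 := (hb p hp w hw).2.2.2 w
    rw [← h.hess_fiber (hBU hp) hw, h.hess_fiber_self (hBU hp) hw] at e1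
    linarith
  refine ⟨lam, K, hlam, hK, fun p hp => h.eq_zero (hBU hp), fun p hp w => (le_abs_self _).trans (hupper p hp w), ?_, ?_, ?_, ?_,
    hfiber_bound, hbase_bound⟩
  · intro p hp w w'
    rcases eq_or_ne w 0 with rfl | hw
    · simpa [h.eq_zero (hBU hp), (hfib0 p hp).fderiv] using hlower p hp w'
    by_cases hseg : ∀ s ∈ Icc (0 : ℝ) 1, w + s • (w' - w) ≠ 0
    · have hc : ∀ s : ℝ, HasDerivAt (fun s : ℝ => w + s • (w' - w)) (w' - w) s := by
        intro s
        simpa using ((hasDerivAt_id s).smul_const (w' - w)).const_add w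
      have := taylor_lower_bound (h := fun s => L p (w + s • (w' - w)))
        (h' := fun s => fderiv ℝ (L p) (w + s • (w' - w)) (w' - w))
        (h'' := fun s => fderiv ℝ (fderiv ℝ (L p)) (w + s • (w' - w)) (w' - w) (w' - w))
        (C := lam * ‖w' - w‖ ^ 2)
        (fun s hs => ((h.hasFDerivAt_fiber (hBU hp)
          (hseg s hs)).differentiableAt.hasFDerivAt).comp_hasDerivAt s (hc s))
        (fun s hs => by
          have h1 := ((h.hasFDerivAt_fiber_fderiv_fiber (hBU hp)
            (hseg s hs)).differentiableAt.hasFDerivAt).comp_hasDerivAt s (hc s)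
          simpa using h1.clm_apply (hasDerivAt_const s (w' - w)))
        (fun s hs => by
          rw [h.hess_fiber (hBU hp) (hseg s hs)]
          linarith [(hb p hp _ (hseg s hs)).2.2.2 (w' - w)])
      simpa using this
    -- If the segment meets 0, Taylor's formula is unavailable. Then w' = −τw with τ ≥ 0, and
    -- Euler's identity with the bounds at w and −w gives the claim, because (1 + τ)² = (1 + 2τ) +
    -- τ².
    · push Not at hseg
      obtain ⟨s, hs, hs0⟩ := hseg
      have hs_ne : s ≠ 0 := by
        rintro rfl
        simp at hs0
        exact hw hs0
      have hs_pos : 0 < s := lt_of_le_of_ne hs.1 (Ne.symm hs_ne)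
      obtain ⟨τ, hτ, hτw⟩ : ∃ τ : ℝ, 0 ≤ τ ∧ w' - w = (-(1 + τ)) • w := by
        refine ⟨s⁻¹ - 1, sub_nonneg.2 ((one_le_inv₀ hs_pos).2 hs.2), ?_⟩
        have e : s • (w' - w) = -w := (neg_eq_of_add_eq_zero_right hs0).symm
        have e2 : w' - w = s⁻¹ • (s • (w' - w)) := by rw [smul_smul, inv_mul_cancel₀ hs_ne, one_smul]
        rw [e2, e]
        simp
      have hw'e : w' = τ • (-w) := by
        have : w' = w + (w' - w) := by abel
        rw [this, hτw]
        module
      have e1 : L p w' = τ ^ 2 * L p (-w) := by rw [hw'e, h.homogeneous p (hBU hp) _ _ hτ]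
      have e2 := hlower p hp (-w)
      have e3 := hlower p hp w
      rw [norm_neg] at e2
      rw [hτw, map_smul, h.fderiv_fiber_self (hBU hp) hw, norm_smul, e1, smul_eq_mul, norm_neg,
        Real.norm_of_nonneg (by linarith)]
      have e4 := mul_le_mul_of_nonneg_left e2 (sq_nonneg τ)
      have e5 := mul_le_mul_of_nonneg_left e3 (by linarith : 0 ≤ 1 + 2 * τ)
      nlinarith [e4, e5]
  · intro p hp q hq w
    rcases eq_or_ne w 0 with rfl | hw
    · simp [h.eq_zero (hBU hp), h.eq_zero (hBU hq), (hbase0 p hp).fderiv]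
    have hlip : ∀ p' ∈ B, ‖fderiv ℝ (fun p => L p w) p' - fderiv ℝ (fun p => L p w) p‖
        ≤ K * ‖w‖ ^ 2 * ‖p' - p‖ := by
      intro p' hp'
      refine Convex.norm_image_sub_le_of_norm_hasFDerivWithin_le
        (f := fun p => fderiv ℝ (fun p => L p w) p) (s := B)
        (fun y hy => (h.hasFDerivAt_base_fderiv_base (hBU hy) hw).hasFDerivWithinAt)
        (fun y hy => ?_) hBc hp hp'
      refine ContinuousLinearMap.opNorm_le_bound₂ _ (by positivity) fun ξ ξ' => ?_
      simpa using (hb y hy w hw).2.2.1 ξ 0 ξ' 0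
    have hseg : segment ℝ p q ⊆ B := hBc.segment_subset hp hq
    -- Mean value inequality for L minus its linearisation at p, whose derivative is small on the
    -- segment by `hlip`.
    have hmain := Convex.norm_image_sub_le_of_norm_hasFDerivWithin_le
        (f := fun y => L y w - fderiv ℝ (fun p => L p w) p y) (s := segment ℝ p q)
        (f' := fun y => fderiv ℝ (fun p => L p w) y - fderiv ℝ (fun p => L p w) p)
        (C := K * ‖w‖ ^ 2 * ‖q - p‖) (x := p) (y := q)
        (fun y hy => (((h.hasFDerivAt_base (hBU (hseg hy))
          hw).differentiableAt.hasFDerivAt).sub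
            (fderiv ℝ (fun p => L p w) p).hasFDerivAt).hasFDerivWithinAt)
        (fun y hy => (hlip y (hseg hy)).trans (by
          gcongr
          rw [segment_eq_image'] at hy
          obtain ⟨s, hs, rfl⟩ := hy
          simp only [add_sub_cancel_left, norm_smul, Real.norm_of_nonneg hs.1]
          exact mul_le_of_le_one_left (norm_nonneg _) hs.2))
        (convex_segment p q) (left_mem_segment ℝ p q) (right_mem_segment ℝ p q)
    rw [Real.norm_eq_abs, abs_le] at hmain
    rw [map_sub]
    nlinarith [hmain.1]
  · intro p hp w w'
    set m := max ‖w‖ ‖w'‖ with hm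
    -- The base derivative is O(‖w‖²), hence differentiable at 0 with derivative 0, and the mean
    -- value inequality applies on a whole ball around 0.
    have hderiv : ∀ y : E, ∃ g' : E →L[ℝ] (E →L[ℝ] ℝ),
        HasFDerivAt (fun w => fderiv ℝ (fun p => L p w) p) g' y ∧ ‖g'‖ ≤ K * ‖y‖ := by
      intro y
      rcases eq_or_ne y 0 with rfl | hy
      · refine ⟨0, Asymptotics.IsBigO.hasFDerivAt (n := 2) ?_ one_lt_two,
          le_of_eq_of_le (norm_zero (E := E →L[ℝ] (E →L[ℝ] ℝ))) (by positivity)⟩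
        refine Asymptotics.IsBigO.of_bound K (Eventually.of_forall fun w => ?_)
        simpa using hbase_bound p hp w
      · refine ⟨_, h.hasFDerivAt_fiber_fderiv_base (hBU hp) hy, ?_⟩
        have hy' : 0 < ‖y‖ := norm_pos_iff.2 hy
        refine ContinuousLinearMap.opNorm_le_bound₂ _ (by positivity) fun ξ ξ' => ?_
        have := (hb p hp y hy).2.2.1 0 ξ ξ' 0
        simp only [norm_zero, zero_add, zero_div, add_zero] at this
        refine (le_of_eq ?_).trans (this.trans_eq ?_)
        · simp
        · field_simp
    choose g' hg' hgb using hderiv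
    have := Convex.norm_image_sub_le_of_norm_hasFDerivWithin_le
        (f := fun w => fderiv ℝ (fun p => L p w) p) (s := Metric.closedBall (0 : E) m)
        (f' := g') (C := K * m) (x := w) (y := w')
        (fun y hy => (hg' y).hasFDerivWithinAt)
        (fun y hy => (hgb y).trans (by
          gcongr
          simpa using hy))
        (convex_closedBall 0 m) (by simp [hm]) (by simp [hm])
    refine this.trans ?_
    gcongr
    exact max_le_add_of_nonneg (norm_nonneg _) (norm_nonneg _)
  · intro p hp q hq w
    rcases eq_or_ne w 0 with rfl | hw
    · simp [(hfib0 p hp).fderiv, (hfib0 q hq).fderiv]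
    have hw' : 0 < ‖w‖ := norm_pos_iff.2 hw
    refine Convex.norm_image_sub_le_of_norm_hasFDerivWithin_le
        (f := fun p => fderiv ℝ (L p) w) (s := B)
        (fun y hy => (h.hasFDerivAt_base_fderiv_fiber (hBU hy) hw).hasFDerivWithinAt)
        (fun y hy => ?_) hBc hp hq
    refine ContinuousLinearMap.opNorm_le_bound₂ _ (by positivity) fun ξ ξ' => ?_
    have := (hb y hy w hw).2.2.1 ξ 0 0 ξ'
    simp only [norm_zero, zero_add, zero_div, add_zero] at this
    refine (le_of_eq ?_).trans (this.trans_eq ?_)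
    · simp
    · field_simp

end IsSmoothLagrangian

namespace HasLagrangianBounds

variable {E : Type*} [NormedAddCommGroup E] [NormedSpace ℝ E] {L : E → E → ℝ} {B : Set E}
  {lam K : ℝ}

theorem lower (h : HasLagrangianBounds L B lam K) {p : E} (hp : p ∈ B) (w : E) :
    lam * ‖w‖ ^ 2 ≤ L p w := by
  have h0 : fderiv ℝ (L p) 0 = 0 := by simpa using h.fiber_bound p hp 0
  simpa [h.eq_zero p hp, h0] using h.convex p hp 0 w

/-- Strong monotonicity of the Legendre map. -/
theorem norm_sub_le (h : HasLagrangianBounds L B lam K) {p : E} (hp : p ∈ B) (w w' : E) :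
    2 * lam * ‖w' - w‖ ≤ ‖fderiv ℝ (L p) w' - fderiv ℝ (L p) w‖ := by
  rcases eq_or_ne w' w with rfl | hne
  · simp
  have hpos : 0 < ‖w' - w‖ := norm_pos_iff.2 (sub_ne_zero.2 hne)
  have h1 := h.convex p hp w w'
  have h2 := h.convex p hp w' w
  rw [← neg_sub w' w, map_neg, norm_neg] at h2
  have h3 := (fderiv ℝ (L p) w' - fderiv ℝ (L p) w).le_opNorm (w' - w)
  rw [_root_.sub_apply, Real.norm_eq_abs] at h3
  have h4 := (le_abs_self _).trans h3
  have h5 : 2 * lam * ‖w' - w‖ * ‖w' - w‖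
      ≤ ‖fderiv ℝ (L p) w' - fderiv ℝ (L p) w‖ * ‖w' - w‖ := by nlinarith
  exact le_of_mul_le_mul_right h5 hpos

end HasLagrangianBounds
end Finsler

/-! ### The calibration inequality for a short extremal. -/

namespace Finsler
namespace HasLagrangianBounds

section Pointwise

variable {E : Type*} [NormedAddCommGroup E] [NormedSpace ℝ E] {L : E → E → ℝ} {B : Set E}
  {lam K : ℝ}

/-- First-order comparison of the Lagrangian at two nearby points, with quadratic remainder. -/
theorem first_order_comparison (h : HasLagrangianBounds L B lam K) {p q : E} (hp : p ∈ B)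
    (hq : q ∈ B) {v w : E} {g δ : ℝ} (hv : ‖v‖ ≤ g) (hδ : ‖q - p‖ ≤ δ) :
    L p v + fderiv ℝ (L p) v (w - v) + fderiv ℝ (fun p => L p v) p (q - p)
      + (lam - K * (g + δ + 2 * δ ^ 2)) * ‖w - v‖ ^ 2 - K * (g + 2 * g ^ 2) * ‖q - p‖ ^ 2
      ≤ L q w := by
  have h1 := h.taylor p hp q hq w
  have h2 := h.convex p hp v w
  have h3 := h.base_lip p hp v w
  have h4 : -(K * (‖v‖ + ‖w‖) * ‖w - v‖ * ‖q - p‖) ≤ fderiv ℝ (fun p => L p w) p (q - p)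
      - fderiv ℝ (fun p => L p v) p (q - p) := by
    have e := (fderiv ℝ (fun p => L p w) p - fderiv ℝ (fun p => L p v) p).le_of_opNorm_le h3 (q - p)
    rw [_root_.sub_apply, Real.norm_eq_abs] at e
    exact neg_le_of_abs_le e
  set x := ‖q - p‖ with hx
  set z := ‖w - v‖ with hz
  have hx0 : 0 ≤ x := norm_nonneg _
  have hz0 : 0 ≤ z := norm_nonneg _
  have hK := h.const_pos
  have hg0 : 0 ≤ g := (norm_nonneg _).trans hv
  have hδ0 : 0 ≤ δ := hx0.trans hδ
  have hw : ‖w‖ ≤ g + z := by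
    have : w = v + (w - v) := by abel
    calc ‖w‖ = ‖v + (w - v)‖ := by rw [← this]
      _ ≤ ‖v‖ + ‖w - v‖ := norm_add_le _ _
      _ ≤ g + z := by gcongr
  have h5 : K * (‖v‖ + ‖w‖) * z * x ≤ K * (g * (z ^ 2 + x ^ 2) + δ * z ^ 2) := by
    have : (‖v‖ + ‖w‖) * z * x ≤ (2 * g + z) * z * x := by
      gcongr ?_ * z * x
      linarith
    have e2 : g * (2 * z * x) ≤ g * (z ^ 2 + x ^ 2) := by
      gcongr
      nlinarith [sq_nonneg (z - x)]
    have e3 : z ^ 2 * x ≤ z ^ 2 * δ := by gcongr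
    have : (‖v‖ + ‖w‖) * z * x ≤ g * (z ^ 2 + x ^ 2) + δ * z ^ 2 := by nlinarith
    calc _ = K * ((‖v‖ + ‖w‖) * z * x) := by ring
      _ ≤ _ := by gcongr
  have h6 : K * ‖w‖ ^ 2 * x ^ 2 ≤ K * (2 * g ^ 2 * x ^ 2 + 2 * δ ^ 2 * z ^ 2) := by
    have e1 : ‖w‖ ^ 2 ≤ 2 * g ^ 2 + 2 * z ^ 2 := by
      calc ‖w‖ ^ 2 ≤ (g + z) ^ 2 := by gcongr
        _ ≤ _ := by nlinarith [sq_nonneg (g - z)]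
    have e2 : z ^ 2 * x ^ 2 ≤ z ^ 2 * δ ^ 2 := by gcongr
    have e3 : ‖w‖ ^ 2 * x ^ 2 ≤ (2 * g ^ 2 + 2 * z ^ 2) * x ^ 2 := by gcongr
    rw [mul_assoc]
    gcongr
    nlinarith
  nlinarith

end Pointwise

variable {E : Type*} [NormedAddCommGroup E] [InnerProductSpace ℝ E] {L : E → E → ℝ} {B : Set E}
  {lam K : ℝ}

/-- The pointwise inequality behind the calibration. The weight (lam/16)(2 − s) is an explicit
Riccati subsolution: its derivative −lam/16 pays for the negative term in ‖q − p‖². After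
Cauchy–Schwarz and 2 − s ≤ 2, the difference of the two sides is at least (lam/2)(‖w − v‖ − ‖q −
p‖/4)²; this fixes the thresholds lam/2 and lam/32. -/
theorem riccati_comparison (h : HasLagrangianBounds L B lam K) {p q : E} (hp : p ∈ B)
    (hq : q ∈ B) {v w : E} {g δ : ℝ} (hv : ‖v‖ ≤ g) (hδ : ‖q - p‖ ≤ δ)
    (hA : K * (g + δ + 2 * δ ^ 2) ≤ lam / 2) (hB : K * (g + 2 * g ^ 2) ≤ lam / 32)
    {s : ℝ} (hs : s ∈ Icc (0 : ℝ) 1) :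
    L p v + fderiv ℝ (L p) v (w - v) + fderiv ℝ (fun p => L p v) p (q - p)
      - lam / 16 * ‖q - p‖ ^ 2 + lam / 16 * (2 - s) * (2 * inner ℝ (q - p) (w - v)) ≤ L q w := by
  have h1 := h.first_order_comparison hp hq (w := w) hv hδ
  have h2 := real_inner_le_norm (q - p) (w - v)
  have hl := h.lam_pos
  set x := ‖q - p‖ with hx
  set z := ‖w - v‖ with hz
  have hx0 : 0 ≤ x := norm_nonneg _
  have hz0 : 0 ≤ z := norm_nonneg _
  have h3 : (2 - s) * inner ℝ (q - p) (w - v) ≤ 2 * (x * z) := by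
    calc _ ≤ (2 - s) * (x * z) := by
          apply mul_le_mul_of_nonneg_left h2
          linarith [hs.2]
      _ ≤ 2 * (x * z) := by
          apply mul_le_mul_of_nonneg_right _ (by positivity)
          linarith [hs.1]
  have h4 : lam / 2 * z ^ 2 ≤ (lam - K * (g + δ + 2 * δ ^ 2)) * z ^ 2 := by
    gcongr; linarith
  have h5 : K * (g + 2 * g ^ 2) * x ^ 2 ≤ lam / 32 * x ^ 2 := by gcongr
  have h6 : 0 ≤ lam * (z - x / 4) ^ 2 := by positivity
  have h7 := mul_le_mul_of_nonneg_left h3 hl.le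
  nlinarith

/-- A solution `γ` of the Euler-Lagrange equations has, among the nearby curves with the same initial
point, least energy up to the boundary term, with a quadratic gain. -/
theorem energy_comparison (h : HasLagrangianBounds L B lam K)
    (hhom : ∀ p ∈ B, ∀ (w : E) (r : ℝ), 0 ≤ r → L p (r • w) = r ^ 2 * L p w)
    {γ γ' α α' : ℝ → E} {f : ℝ → ℝ} {e g δ : ℝ}
    (hγ : ∀ s ∈ Icc (0 : ℝ) 1, HasDerivWithinAt γ (γ' s) (Icc 0 1) s)
    (hEL : ∀ s ∈ Icc (0 : ℝ) 1, HasDerivWithinAt (fun s => fderiv ℝ (L (γ s)) (γ' s))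
      (fderiv ℝ (fun p => L p (γ' s)) (γ s)) (Icc 0 1) s)
    (hγB : ∀ s ∈ Icc (0 : ℝ) 1, γ s ∈ B) (hγe : ∀ s ∈ Icc (0 : ℝ) 1, L (γ s) (γ' s) = e)
    (hγg : ∀ s ∈ Icc (0 : ℝ) 1, ‖γ' s‖ ≤ g)
    (hα : ∀ t ∈ Icc (0 : ℝ) 1, HasDerivWithinAt α (α' t) (Icc 0 1) t)
    (hαB : ∀ t ∈ Icc (0 : ℝ) 1, α t ∈ B) (hf : Continuous f)
    (hf0 : ∀ t ∈ Icc (0 : ℝ) 1, 0 ≤ f t)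
    (hαf : ∀ t ∈ Icc (0 : ℝ) 1, L (α t) (α' t) = (1 / 2) * f t ^ 2) (h0 : α 0 = γ 0)
    (hδ : ∀ t ∈ Icc (0 : ℝ) 1, ∀ s ∈ Icc (0 : ℝ) 1, ‖α t - γ s‖ ≤ δ)
    (hA : K * (g + δ + 2 * δ ^ 2) ≤ lam / 2) (hB : K * (g + 2 * g ^ 2) ≤ lam / 32) :
    e + fderiv ℝ (L (γ 1)) (γ' 1) (α 1 - γ 1) + lam / 16 * ‖α 1 - γ 1‖ ^ 2
      ≤ (1 / 2) * (∫ t in (0 : ℝ)..1, f t) ^ 2 := by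
  set G : ℝ → ℝ := fun t => ∫ τ in (0 : ℝ)..t, f τ with hG
  have hGd : ∀ t, HasDerivAt G (f t) t := fun t => (hf.integral_hasStrictDerivAt 0 t).hasDerivAt
  have hG0 : G 0 = 0 := by simp [hG]
  set l := ∫ t in (0 : ℝ)..1, f t with hl
  have hG1 : G 1 = l := rfl
  have hl0 : 0 ≤ l := intervalIntegral.integral_nonneg zero_le_one hf0
  set X := e + fderiv ℝ (L (γ 1)) (γ' 1) (α 1 - γ 1) + lam / 16 * ‖α 1 - γ 1‖ ^ 2 with hX
  -- The speed f may vanish, so arc length is regularised by d > 0, making the time change strictly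
  -- increasing. The limit d → 0 is taken at the end.
  have key : ∀ d : ℝ, 0 < d → X ≤ (1 / 2) * (l + d) * l := by
    intro d hd
    have hld : 0 < l + d := by linarith
    set θ : ℝ → ℝ := fun t => (G t + d * t) / (l + d) with hθ
    have hθd : ∀ t, HasDerivAt θ ((f t + d) / (l + d)) t := by
      intro t
      simpa using ((hGd t).fun_add ((hasDerivAt_id' t).const_mul d)).div_const (l + d)
    have hθ0 : θ 0 = 0 := by simp [hθ, hG0]
    have hθ1 : θ 1 = 1 := by simp [hθ, hG1, hld.ne']
    have hθc : Continuous θ := continuous_iff_continuousAt.2 fun t => (hθd t).continuousAt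
    have hθmono : StrictMonoOn θ (Icc 0 1) := by
      refine strictMonoOn_of_deriv_pos (convex_Icc 0 1) hθc.continuousOn fun t ht => ?_
      rw [(hθd t).deriv]
      have := hf0 t (interior_subset ht)
      positivity
    have h0mem : (0 : ℝ) ∈ Icc (0 : ℝ) 1 := left_mem_Icc.2 zero_le_one
    have h1mem : (1 : ℝ) ∈ Icc (0 : ℝ) 1 := right_mem_Icc.2 zero_le_one
    have hθIcc : MapsTo θ (Icc 0 1) (Icc 0 1) := by
      intro t ht
      have e1 := hθmono.monotoneOn h0mem ht ht.1
      have e2 := hθmono.monotoneOn ht h1mem ht.2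
      rw [hθ0] at e1
      rw [hθ1] at e2
      exact ⟨e1, e2⟩
    -- Interior times go to interior times, where the one-sided derivatives of γ and of its momentum
    -- are two-sided and the chain rule applies.
    have hθIoo : MapsTo θ (Ioo 0 1) (Ioo 0 1) := by
      intro t ht
      have e1 := hθmono h0mem (Ioo_subset_Icc_self ht) ht.1
      have e2 := hθmono (Ioo_subset_Icc_self ht) h1mem ht.2
      rw [hθ0] at e1
      rw [hθ1] at e2
      exact ⟨e1, e2⟩
    set m : ℝ → (E →L[ℝ] ℝ) := fun s => fderiv ℝ (L (γ s)) (γ' s) with hm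
    set ξ : ℝ → E := fun t => α t - γ (θ t) with hξ
    -- The calibrating function. It vanishes at 0 since α and γ start together, and at 1 its weight
    -- 2 − θ equals 1, so its value is X.
    set Φ : ℝ → ℝ := fun t => e * θ t + m (θ t) (ξ t) + lam / 16 * (2 - θ t) * ‖ξ t‖ ^ 2 with hΦ
    have hγc : ContinuousOn γ (Icc 0 1) := fun s hs => (hγ s hs).continuousWithinAt
    have hmc : ContinuousOn m (Icc 0 1) := fun s hs => (hEL s hs).continuousWithinAt
    have hαc : ContinuousOn α (Icc 0 1) := fun s hs => (hα s hs).continuousWithinAt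
    have hξc : ContinuousOn ξ (Icc 0 1) := hαc.sub (hγc.comp hθc.continuousOn hθIcc)
    have hΦc : ContinuousOn Φ (Icc 0 1) := by
      refine ((continuousOn_const.mul hθc.continuousOn).add
        ((hmc.comp hθc.continuousOn hθIcc).clm_apply hξc)).add ?_
      exact (continuousOn_const.mul (continuousOn_const.sub hθc.continuousOn)).mul (hξc.norm.pow 2)
    have hmono : MonotoneOn (fun t => (1 / 2) * (l + d) * G t - Φ t) (Icc 0 1) := by
      set c : ℝ → ℝ := fun t => (f t + d) / (l + d) with hc
      set ξ' : ℝ → E := fun t => α' t - c t • γ' (θ t) with hξ'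
      refine monotoneOn_of_hasDerivWithinAt_nonneg (convex_Icc 0 1)
        (f' := fun t => (1 / 2) * (l + d) * f t - (e * c t
          + ((c t • fderiv ℝ (fun p => L p (γ' (θ t))) (γ (θ t))) (ξ t) + m (θ t) (ξ' t))
          + (lam / 16 * (-c t) * ‖ξ t‖ ^ 2 + lam / 16 * (2 - θ t) * (2 * inner ℝ (ξ t) (ξ' t)))))
        ((continuousOn_const.mul fun t _ => (hGd t).continuousAt.continuousWithinAt).sub hΦc) ?_ ?_
      · intro t ht
        rw [interior_Icc] at ht
        have ht' := Ioo_subset_Icc_self ht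
        have hθt := hθIoo ht
        have hnt : Icc (0 : ℝ) 1 ∈ 𝓝 t := Icc_mem_nhds ht.1 ht.2
        have hnθ : Icc (0 : ℝ) 1 ∈ 𝓝 (θ t) := Icc_mem_nhds hθt.1 hθt.2
        have d1 : HasDerivAt α (α' t) t := (hα t ht').hasDerivAt hnt
        have d2 : HasDerivAt (fun t => γ (θ t)) (c t • γ' (θ t)) t :=
          HasDerivAt.scomp t ((hγ _ (hθIcc ht')).hasDerivAt hnθ) (hθd t)
        have d3 : HasDerivAt (fun t => m (θ t))
            (c t • fderiv ℝ (fun p => L p (γ' (θ t))) (γ (θ t))) t :=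
          HasDerivAt.scomp t ((hEL _ (hθIcc ht')).hasDerivAt hnθ) (hθd t)
        have d4 : HasDerivAt ξ (ξ' t) t := d1.fun_sub d2
        have d5 : HasDerivAt (fun t => ‖ξ t‖ ^ 2) (2 * inner ℝ (ξ t) (ξ' t)) t := d4.norm_sq
        have d6 : HasDerivAt (fun t => lam / 16 * (2 - θ t)) (lam / 16 * (-c t)) t := by
          simpa using ((hθd t).const_sub 2).const_mul (lam / 16)
        exact (((hGd t).const_mul _).fun_sub ((((hθd t).const_mul e).fun_add
          (d3.clm_apply d4)).fun_add (d6.fun_mul d5))).hasDerivWithinAt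
      · intro t ht
        have ht' := interior_subset ht
        have hft := hf0 t ht'
        have hct : 0 < c t := by positivity
        set w := (c t)⁻¹ • α' t with hw
        have hξw : ξ' t = c t • (w - γ' (θ t)) := by
          rw [hξ', smul_sub, hw, smul_smul, mul_inv_cancel₀ hct.ne', one_smul]
        have hric := h.riccati_comparison (hγB _ (hθIcc ht')) (hαB t ht') (w := w)
          (hγg _ (hθIcc ht')) (hδ t ht' _ (hθIcc ht')) hA hB (hθIcc ht')
        rw [hγe _ (hθIcc ht')] at hric
        -- By homogeneity the left side is f²/(2c) with c = (f + d)/(l + d), which is at most (l +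
        -- d)f/2 because f ≤ f + d.
        have hLw : c t * L (α t) w ≤ (1 / 2) * (l + d) * f t := by
          rw [hw, hhom _ (hαB t ht') _ _ (inv_nonneg.2 hct.le), hαf t ht']
          have : c t * ((c t)⁻¹ ^ 2 * (1 / 2 * f t ^ 2))
              = (1 / 2) * (l + d) * f t * (f t / (f t + d)) := by
            simp only [hc]
            have : f t + d ≠ 0 := by positivity
            field_simp
          rw [this]
          refine mul_le_of_le_one_right (by positivity) ?_
          rw [div_le_one (by positivity)]
          linarith
        have := mul_le_mul_of_nonneg_left hric hct.le
        rw [hξw]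
        simp only [map_smul, inner_smul_right, _root_.smul_apply, smul_eq_mul]
        simp only [hξ, hm]
        nlinarith
    have hfin := hmono h0mem h1mem zero_le_one
    have hΦ0 : Φ 0 = 0 := by simp [hΦ, hξ, hθ0, h0]
    have hΦ1 : Φ 1 = X := by
      simp only [hΦ, hξ, hθ1, hm, hX]
      ring
    simp only [hG0, hG1, hΦ0, hΦ1] at hfin
    linarith
  rcases hl0.eq_or_lt with hl0 | hl0
  · have := key 1 one_pos
    rw [← hl0] at this ⊢
    simpa using this
  · refine le_of_forall_pos_le_add fun r hr => ?_
    have := key (2 * r / l) (by positivity)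
    have e : 1 / 2 * (l + 2 * r / l) * l = 1 / 2 * l ^ 2 + r := by field_simp
    linarith

end HasLagrangianBounds
end Finsler

/-! ### The Finsler metric and curves read in a chart. -/

namespace Finsler

variable {n : ℕ} {M : Type*} [TopologicalSpace M] [ChartedSpace (EuclideanSpace ℝ (Fin n)) M]
  [IsManifold (𝓡 n) ∞ M] {F : TangentBundle (𝓡 n) M → ℝ}
  {e : OpenPartialHomeomorph M (EuclideanSpace ℝ (Fin n))}

theorem IsFinslerMetric.apply_zero (hF : IsFinslerMetric F) (x : M) :
    F ⟨x, (0 : EuclideanSpace ℝ (Fin n))⟩ = 0 := by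
  have := hF.homogeneous x 0 0 le_rfl
  rwa [zero_smul, zero_mul] at this

theorem IsFinslerMetric.nonneg (hF : IsFinslerMetric F) (v : TangentBundle (𝓡 n) M) : 0 ≤ F v := by
  obtain ⟨x, X⟩ := v
  by_cases hX : X = 0
  · subst hX
    exact (hF.apply_zero x).ge
  · exact (hF.pos x X hX).le

theorem mdifferentiable_of_mem_atlas_infty (he : e ∈ atlas (EuclideanSpace ℝ (Fin n)) M) :
    e.MDifferentiable (𝓡 n) (𝓡 n) := by
  have : IsManifold (𝓡 n) 1 M := IsManifold.of_le (n := ∞) (by simp)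
  exact mdifferentiable_of_mem_atlas he

/-- The differential of the inverse of a chart, as a linear equivalence. -/
noncomputable def chartSymmDeriv (he : e ∈ atlas (EuclideanSpace ℝ (Fin n)) M)
    {p : EuclideanSpace ℝ (Fin n)} (hp : p ∈ e.target) :
    EuclideanSpace ℝ (Fin n) ≃L[ℝ] EuclideanSpace ℝ (Fin n) :=
  (mdifferentiable_of_mem_atlas_infty he).symm.mfderiv (x := p) hp

theorem contMDiff_tangentBundle_mk (V : Type*) [NormedAddCommGroup V] [NormedSpace ℝ V] :
    ContMDiff 𝓘(ℝ, V × V) 𝓘(ℝ, V).tangent ∞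
      (fun z : V × V => (⟨z.1, z.2⟩ : TangentBundle 𝓘(ℝ, V) V)) := by
  intro z
  rw [Bundle.contMDiffAt_totalSpace]
  refine ⟨contDiff_fst.contMDiff.contMDiffAt, ?_⟩
  refine contDiff_snd.contMDiff.contMDiffAt.congr_of_eventuallyEq (Eventually.of_forall fun y => ?_)
  exact congrArg Prod.snd (trivializationAt_model_space_apply (I := 𝓘(ℝ, V)) _ _)

theorem contMDiffOn_chart_symm_tangent (he : e ∈ atlas (EuclideanSpace ℝ (Fin n)) M) :
    ContMDiffOn 𝓘(ℝ, EuclideanSpace ℝ (Fin n) × EuclideanSpace ℝ (Fin n)) (𝓡 n).tangent ∞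
      (fun z : EuclideanSpace ℝ (Fin n) × EuclideanSpace ℝ (Fin n) =>
        (⟨e.symm z.1, mfderiv (𝓡 n) (𝓡 n) e.symm z.1 z.2⟩ : TangentBundle (𝓡 n) M))
      (e.target ×ˢ univ) := by
  have : IsManifold (𝓡 n) 1 M := IsManifold.of_le (n := ∞) (by simp)
  have h1 : ContMDiffOn (𝓡 n) (𝓡 n) ∞ e.symm e.target :=
    contMDiffOn_symm_of_mem_maximalAtlas (IsManifold.subset_maximalAtlas he)
  have h2 := h1.contMDiffOn_tangentMapWithin (m := ∞) (by simp) e.open_target.uniqueMDiffOn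
  have h3 := h2.comp (contMDiff_tangentBundle_mk (EuclideanSpace ℝ (Fin n))).contMDiffOn (s := e.target ×ˢ univ)
    (fun z hz => hz.1)
  refine h3.congr fun z hz => ?_
  simp only [Function.comp_apply, tangentMapWithin]
  rw [mfderivWithin_of_isOpen e.open_target hz.1]

/-- On each fibre the differential of the inverse chart is a linear isomorphism A. It preserves
non-zero vectors, and the Hessian of the chart Lagrangian is the fundamental tensor pulled back by
A. -/
theorem IsFinslerMetric.isSmoothLagrangian (hF : IsFinslerMetric F)
    (he : e ∈ atlas (EuclideanSpace ℝ (Fin n)) M) :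
    IsSmoothLagrangian (chartLagrangian F e) e.target where
  isOpen := e.open_target
  smooth := by
    have h1 : ContMDiffOn 𝓘(ℝ, EuclideanSpace ℝ (Fin n) × EuclideanSpace ℝ (Fin n)) 𝓘(ℝ, ℝ) ∞
        (fun z : EuclideanSpace ℝ (Fin n) × EuclideanSpace ℝ (Fin n) =>
          F ⟨e.symm z.1, mfderiv (𝓡 n) (𝓡 n) e.symm z.1 z.2⟩) (e.target ×ˢ {0}ᶜ) :=
      hF.smooth.comp ((contMDiffOn_chart_symm_tangent he).mono
        (prod_mono_right (subset_univ _))) (fun z hz => by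
          change chartSymmDeriv he hz.1 z.2 ≠ 0
          exact (chartSymmDeriv he hz.1).map_ne_zero_iff.2 hz.2)
    have h2 := (contMDiffOn_iff_contDiffOn.1 h1)
    exact contDiffOn_const.mul (h2.pow 2)
  homogeneous := by
    intro p hp w r hr
    have h1 : F ⟨e.symm p, mfderiv (𝓡 n) (𝓡 n) e.symm p (r • w)⟩
        = r * F ⟨e.symm p, mfderiv (𝓡 n) (𝓡 n) e.symm p w⟩ :=
      (congrArg (fun v => F ⟨e.symm p, v⟩)
        ((mfderiv (𝓡 n) (𝓡 n) e.symm p).map_smul r w)).trans (hF.homogeneous _ _ _ hr)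
    unfold chartLagrangian
    refine (congrArg (fun y : ℝ => 1 / 2 * y ^ 2) h1).trans ?_
    ring
  posDef := by
    intro p hp w u hw hu
    set A := chartSymmDeriv he hp with hA
    set f : EuclideanSpace ℝ (Fin n) → ℝ := fun Z => F ⟨e.symm p, Z⟩ ^ 2 with hf
    have hL : chartLagrangian F e p = (1 / 2 : ℝ) • (f ∘ A) := rfl
    have h1 : fderiv ℝ (chartLagrangian F e p) = (1 / 2 : ℝ) • fderiv ℝ (f ∘ A) := by
      ext1 z
      rw [hL, fderiv_const_smul_field]
    have h2 : fderiv ℝ (fderiv ℝ (chartLagrangian F e p)) w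
        = (1 / 2 : ℝ) • fderiv ℝ (fderiv ℝ (f ∘ A)) w := by
      rw [h1]
      exact congrFun (fderiv_const_smul_field (1 / 2 : ℝ) (f := fderiv ℝ (f ∘ A))) w
    have h3 := A.iteratedFDerivWithin_comp_right f uniqueDiffOn_univ (mem_univ (A w)) 2
    rw [preimage_univ, iteratedFDerivWithin_univ, iteratedFDerivWithin_univ] at h3
    have h4 := congrArg (fun T => T ![u, u]) h3
    simp only [iteratedFDeriv_two_apply] at h4
    have h5 := hF.posDef (e.symm p) (A w) (A u) (A.map_ne_zero_iff.2 hw) (A.map_ne_zero_iff.2 hu)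
    have h6 : fundamentalTensor F (e.symm p) (A w) (A u) (A u)
        = fderiv ℝ (fderiv ℝ (chartLagrangian F e p)) w u u := by
      rw [h2]
      simp only [fundamentalTensor, _root_.smul_apply, smul_eq_mul]
      congr 1
      simp only [Matrix.cons_val_zero, Matrix.cons_val_one] at h4
      rw [h4]
      simp [iteratedFDeriv_two_apply, hf]
    rwa [← h6]

theorem derivWithin_chart_comp (he : e ∈ atlas (EuclideanSpace ℝ (Fin n)) M) {γ : ℝ → M}
    {s : Set ℝ} {t : ℝ} (hs : UniqueDiffWithinAt ℝ s t)
    (hγ : MDifferentiableWithinAt 𝓘(ℝ, ℝ) (𝓡 n) γ s t) (ht : γ t ∈ e.source) :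
    derivWithin (e ∘ γ) s t
      = mfderiv (𝓡 n) (𝓡 n) e (γ t) (mfderivWithin 𝓘(ℝ, ℝ) (𝓡 n) γ s t (1 : ℝ)) := by
  have h1 := (mdifferentiable_of_mem_atlas_infty he).mdifferentiableAt ht
  have h2 := mfderiv_comp_mfderivWithin t h1 hγ hs.uniqueMDiffWithinAt
  rw [mfderivWithin_eq_fderivWithin] at h2
  rw [← fderivWithin_derivWithin]
  exact congrArg (fun A : ℝ →L[ℝ] EuclideanSpace ℝ (Fin n) => A 1) h2

theorem mfderivWithin_eq_chart_symm (he : e ∈ atlas (EuclideanSpace ℝ (Fin n)) M) {γ : ℝ → M}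
    {s : Set ℝ} {t : ℝ} (hs : UniqueDiffWithinAt ℝ s t)
    (hγ : MDifferentiableWithinAt 𝓘(ℝ, ℝ) (𝓡 n) γ s t) (ht : γ t ∈ e.source) :
    (mfderivWithin 𝓘(ℝ, ℝ) (𝓡 n) γ s t (1 : ℝ) : EuclideanSpace ℝ (Fin n))
      = mfderiv (𝓡 n) (𝓡 n) e.symm (e (γ t)) (derivWithin (e ∘ γ) s t) := by
  refine Eq.trans ?_ (congrArg (mfderiv (𝓡 n) (𝓡 n) e.symm (e (γ t)))
    (derivWithin_chart_comp he hs hγ ht)).symm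
  have h := (mdifferentiable_of_mem_atlas_infty he).symm_comp_deriv ht
  exact (congrArg (fun A : EuclideanSpace ℝ (Fin n) →L[ℝ] EuclideanSpace ℝ (Fin n) =>
    A (mfderivWithin 𝓘(ℝ, ℝ) (𝓡 n) γ s t (1 : ℝ))) h).symm

theorem chartLagrangian_velocity (F : TangentBundle (𝓡 n) M → ℝ)
    (he : e ∈ atlas (EuclideanSpace ℝ (Fin n)) M) {γ : ℝ → M}
    {s : Set ℝ} {t : ℝ} (hs : UniqueDiffWithinAt ℝ s t)
    (hγ : MDifferentiableWithinAt 𝓘(ℝ, ℝ) (𝓡 n) γ s t) (ht : γ t ∈ e.source) :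
    chartLagrangian F e (e (γ t)) (derivWithin (e ∘ γ) s t) = (1 / 2) * F (velocity γ s t) ^ 2 := by
  have h1 : ∀ v : EuclideanSpace ℝ (Fin n), (⟨e.symm (e (γ t)), v⟩ : TangentBundle (𝓡 n) M)
      = ⟨γ t, v⟩ := fun v => by
    exact congrArg (fun y => (⟨y, v⟩ : TangentBundle (𝓡 n) M)) (e.left_inv ht)
  have h2 : velocity γ s t = ⟨e.symm (e (γ t)),
      mfderiv (𝓡 n) (𝓡 n) e.symm (e (γ t)) (derivWithin (e ∘ γ) s t)⟩ := by
    refine Eq.trans ?_ (h1 _).symm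
    exact congrArg (fun v : EuclideanSpace ℝ (Fin n) => (⟨γ t, v⟩ : TangentBundle (𝓡 n) M))
      (mfderivWithin_eq_chart_symm he hs hγ ht)
  exact congrArg (fun v => 1 / 2 * F v ^ 2) h2.symm

theorem contDiffWithinAt_chart_comp (he : e ∈ atlas (EuclideanSpace ℝ (Fin n)) M) {γ : ℝ → M}
    {s : Set ℝ} {t : ℝ} {k : WithTop ℕ∞} (hk : k ≤ ∞)
    (hγ : ContMDiffWithinAt 𝓘(ℝ, ℝ) (𝓡 n) k γ s t) (ht : γ t ∈ e.source) :
    ContDiffWithinAt ℝ k (e ∘ γ) s t := by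
  have h1 : ContMDiffAt (𝓡 n) (𝓡 n) ∞ e (γ t) :=
    contMDiffAt_of_mem_maximalAtlas (IsManifold.subset_maximalAtlas he) ht
  exact contMDiffWithinAt_iff_contDiffWithinAt.1 ((h1.of_le hk).comp_contMDiffWithinAt t hγ)

theorem hasDerivWithinAt_chart_comp (he : e ∈ atlas (EuclideanSpace ℝ (Fin n)) M) {γ : ℝ → M}
    {s : Set ℝ} {t : ℝ} (hγ : ContMDiffWithinAt 𝓘(ℝ, ℝ) (𝓡 n) 1 γ s t) (ht : γ t ∈ e.source) :
    HasDerivWithinAt (e ∘ γ) (derivWithin (e ∘ γ) s t) s t :=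
  ((contDiffWithinAt_chart_comp he (by simp) hγ ht).differentiableWithinAt
    (by simp)).hasDerivWithinAt

theorem continuousOn_speed (hF : IsFinslerMetric F) {γ : ℝ → M} {a b : ℝ} (hab : a < b)
    (hγ : ContMDiffOn 𝓘(ℝ, ℝ) (𝓡 n) 1 γ (Icc a b)) :
    ContinuousOn (fun t => F (velocity γ (Icc a b) t)) (Icc a b) := by
  have : IsManifold (𝓡 n) 1 M := IsManifold.of_le (n := ∞) (by simp)
  have h1 := hγ.continuousOn_tangentMapWithin le_rfl (uniqueDiffOn_Icc hab).uniqueMDiffOn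
  have h2 : Continuous (fun t : ℝ => (⟨t, (1 : ℝ)⟩ : TangentBundle 𝓘(ℝ, ℝ) ℝ)) := by
    exact (contMDiff_tangentBundle_mk ℝ).continuous.comp (by fun_prop : Continuous fun t : ℝ => (t, (1 : ℝ)))
  exact hF.continuous.comp_continuousOn (h1.comp h2.continuousOn fun t ht => ht)

end Finsler

/-! ### Confinement to a chart, near-straightness of extremals, constant speed. -/

namespace Finsler

/-- A continuous function on `[a,b]` with vanishing derivative wherever it is non-zero is constant. -/
theorem constant_of_hasDerivWithinAt_zero_of_ne_zero {f : ℝ → ℝ} {a b : ℝ}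
    (hf0 : ∀ t ∈ Icc a b, 0 ≤ f t) (hfc : ContinuousOn f (Icc a b))
    (hf : ∀ t ∈ Icc a b, f t ≠ 0 → HasDerivWithinAt f 0 (Icc a b) t) {t : ℝ} (ht : t ∈ Icc a b) :
    f t = f a := by
  -- Truncation at κ > 0 makes f locally constant near its zeros, and it does not destroy a zero
  -- derivative elsewhere; then κ is lowered to f a and to f t.
  have hmax : ∀ κ : ℝ, 0 < κ → ∀ t ∈ Icc a b, max (f t) κ = max (f a) κ := by
    intro κ hκ
    have hd : ∀ t ∈ Icc a b, HasDerivWithinAt (fun t => max (f t) κ) 0 (Icc a b) t := by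
      intro t ht
      by_cases h0 : f t = 0
      · have hev : ∀ᶠ τ in 𝓝[Icc a b] t, f τ < κ :=
          (hfc t ht).eventually_lt continuousWithinAt_const (by rw [h0]; exact hκ)
        refine (hasDerivWithinAt_const t (Icc a b) κ).congr_of_eventuallyEq ?_ ?_
        · filter_upwards [hev] with τ hτ using max_eq_right hτ.le
        · rw [h0]; exact max_eq_right hκ.le
      · have h1 := hf t ht h0
        rw [hasDerivWithinAt_iff_isLittleO] at h1 ⊢
        refine Asymptotics.IsBigO.trans_isLittleO ?_ h1
        refine Asymptotics.IsBigO.of_bound 1 (Eventually.of_forall fun τ => ?_)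
        simp only [smul_zero, sub_zero, one_mul, Real.norm_eq_abs]
        exact abs_max_sub_max_le_abs _ _ _
    refine constant_of_derivWithin_zero (fun t ht => (hd t ht).differentiableWithinAt)
      (fun t ht => ?_)
    exact (hd t (Ico_subset_Icc_self ht)).derivWithin
      (uniqueDiffOn_Icc (ht.1.trans_lt ht.2) t (Ico_subset_Icc_self ht))
  have ha : a ∈ Icc a b := left_mem_Icc.2 (ht.1.trans ht.2)
  refine le_antisymm ?_ ?_
  · refine le_of_forall_gt_imp_ge_of_dense fun κ hκ => ?_
    have := hmax κ ((hf0 a ha).trans_lt hκ) t ht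
    rw [max_eq_right hκ.le] at this
    exact this ▸ le_max_left _ _
  · refine le_of_forall_gt_imp_ge_of_dense fun κ hκ => ?_
    have := hmax κ ((hf0 t ht).trans_lt hκ) t ht
    rw [max_eq_right hκ.le] at this
    exact this ▸ le_max_left _ _

section Confinement

variable {E M : Type*} [NormedAddCommGroup E] [NormedSpace ℝ E] [FiniteDimensional ℝ E]
  [TopologicalSpace M] [T2Space M]

/-- A curve whose velocity in a chart is bounded by `g` cannot leave a ball of radius `∫ g` of the
chart. -/
theorem mem_source_and_norm_sub_le (e : OpenPartialHomeomorph M E) {y : E} {R : ℝ}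
    (hR : Metric.closedBall y R ⊆ e.target) {α : ℝ → M} {u' : ℝ → E} {g G : ℝ → ℝ}
    (hα : ContinuousOn α (Icc 0 1)) (hα0 : α 0 ∈ e.source)
    (hG : ∀ t, HasDerivAt G (g t) t) (hG0 : G 0 = 0) (hg : ∀ t ∈ Icc (0 : ℝ) 1, 0 ≤ g t)
    (hu : ∀ t ∈ Icc (0 : ℝ) 1, α t ∈ e.source → e (α t) ∈ Metric.closedBall y R →
      HasDerivWithinAt (e ∘ α) (u' t) (Icc 0 1) t ∧ ‖u' t‖ ≤ g t)
    (hlt : ‖e (α 0) - y‖ + G 1 < R) :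
    ∀ t ∈ Icc (0 : ℝ) 1, α t ∈ e.source ∧ ‖e (α t) - e (α 0)‖ ≤ G t := by
  have : ProperSpace E := FiniteDimensional.proper ℝ E
  have hGc : Continuous G := continuous_iff_continuousAt.2 fun t => (hG t).continuousAt
  have hGmono : MonotoneOn G (Icc 0 1) :=
    monotoneOn_of_hasDerivWithinAt_nonneg (convex_Icc 0 1) hGc.continuousOn
      (fun t _ => (hG t).hasDerivWithinAt) (fun t ht => hg t (interior_subset ht))
  have h1mem : (1 : ℝ) ∈ Icc (0 : ℝ) 1 := right_mem_Icc.2 zero_le_one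
  set W : Set M := e.symm '' Metric.closedBall y R with hW
  -- The Hausdorff property enters here: the compact image of the coordinate ball is closed in M, so
  -- a curve cannot leave the chart at a limit time. The rest is continuous induction on [0,1].
  have hWc : IsClosed W :=
    ((isCompact_closedBall y R).image_of_continuousOn (e.continuousOn_symm.mono hR)).isClosed
  have hWs : ∀ z ∈ W, z ∈ e.source := by
    rintro _ ⟨q, hq, rfl⟩
    exact e.map_target (hR hq)
  have hWmem : ∀ z ∈ e.source, e z ∈ Metric.closedBall y R → z ∈ W := fun z hz hzb =>
    ⟨e z, hzb, e.left_inv hz⟩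
  set S : Set ℝ := {t | α t ∈ e.source ∧ ‖e (α t) - e (α 0)‖ ≤ G t} with hS
  have hSball : ∀ t ∈ S, t ∈ Icc (0 : ℝ) 1 → ‖e (α t) - y‖ < R := by
    intro t ht ht'
    calc ‖e (α t) - y‖ = ‖(e (α t) - e (α 0)) + (e (α 0) - y)‖ := by rw [sub_add_sub_cancel]
      _ ≤ ‖e (α t) - e (α 0)‖ + ‖e (α 0) - y‖ := norm_add_le _ _
      _ ≤ G 1 + ‖e (α 0) - y‖ := by
        gcongr
        exact ht.2.trans (hGmono ht' h1mem ht'.2)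
      _ < R := by linarith
  have hclosed : IsClosed (S ∩ Icc 0 1) := by
    have hK : IsClosed (Icc (0 : ℝ) 1 ∩ α ⁻¹' W) := hα.preimage_isClosed_of_isClosed isClosed_Icc hWc
    have hc : ContinuousOn (fun t => ‖e (α t) - e (α 0)‖) (Icc (0 : ℝ) 1 ∩ α ⁻¹' W) := by
      refine ContinuousOn.norm (ContinuousOn.sub ?_ continuousOn_const)
      exact e.continuousOn.comp (hα.mono inter_subset_left) fun t ht => hWs _ ht.2
    have h1 := hK.isClosed_le hc hGc.continuousOn
    convert h1 using 1
    ext t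
    constructor
    · rintro ⟨ht, ht'⟩
      exact ⟨⟨ht', hWmem _ ht.1 (by simpa [dist_eq_norm] using (hSball t ht ht').le)⟩, ht.2⟩
    · rintro ⟨⟨ht', htW⟩, ht⟩
      exact ⟨⟨hWs _ htW, ht⟩, ht'⟩
  have hsub := hclosed.Icc_subset_of_forall_exists_gt (by simp [hS, hα0, hG0]) ?_
  · exact fun t ht => hsub ht
  rintro t ⟨htS, ht⟩ z hz
  have ht' : t ∈ Icc (0 : ℝ) 1 := Ico_subset_Icc_self ht
  have hnhd : Icc (0 : ℝ) 1 ∈ 𝓝[≥] t := mem_of_superset (Icc_mem_nhdsGE ht.2)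
    (Icc_subset_Icc_left ht.1)
  have hαt : ContinuousWithinAt α (Ici t) t := (hα t ht').mono_of_mem_nhdsWithin hnhd
  have hev1 : ∀ᶠ τ in 𝓝[≥] t, α τ ∈ e.source := hαt (e.open_source.mem_nhds htS.1)
  have hev2 : ∀ᶠ τ in 𝓝[≥] t, ‖e (α τ) - y‖ < R := by
    have h1 : ContinuousWithinAt (fun τ => ‖e (α τ) - y‖) (Ici t) t :=
      (((e.continuousAt htS.1).comp_continuousWithinAt hαt).sub continuousWithinAt_const).norm
    exact h1.eventually_lt continuousWithinAt_const (hSball t htS ht')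
  obtain ⟨z', hz', hz'sub⟩ := (mem_nhdsGE_iff_exists_Icc_subset).1 ((hev1.and hev2).and hnhd)
  set τ := min z z' with hτ
  have htτ : t < τ := lt_min hz hz'
  have hmem : ∀ r ∈ Icc t τ, (α r ∈ e.source ∧ ‖e (α r) - y‖ < R) ∧ r ∈ Icc (0 : ℝ) 1 :=
    fun r hr => hz'sub ⟨hr.1, hr.2.trans (min_le_right _ _)⟩
  have hder : ∀ r ∈ Icc t τ, HasDerivWithinAt (e ∘ α) (u' r) (Icc 0 1) r ∧ ‖u' r‖ ≤ g r :=
    fun r hr => hu r (hmem r hr).2 (hmem r hr).1.1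
      (by simpa [dist_eq_norm] using (hmem r hr).1.2.le)
  have hsub' : Icc t τ ⊆ Icc (0 : ℝ) 1 := fun r hr => (hmem r hr).2
  have hmvt := image_norm_le_of_norm_deriv_right_le_deriv_boundary (a := t) (b := τ)
    (f := fun r => (e ∘ α) r - (e ∘ α) t) (f' := u') (B := fun r => G r - G t) (B' := g)
    (fun r hr => (((hder r hr).1.continuousWithinAt).mono hsub').sub continuousWithinAt_const)
    (fun r hr => by
      have hr' := Ico_subset_Icc_self hr
      have h1 : r < 1 := hr.2.trans_le (hmem τ (right_mem_Icc.2 htτ.le)).2.2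
      have hn : Icc (0 : ℝ) 1 ∈ 𝓝[≥] r := mem_of_superset (Icc_mem_nhdsGE h1)
        (Icc_subset_Icc_left (hmem r hr').2.1)
      exact ((hder r hr').1.mono_of_mem_nhdsWithin hn).sub_const _)
    (by simp) (fun r => (hG r).sub_const _) (fun r hr => (hder r (Ico_subset_Icc_self hr)).2)
    (right_mem_Icc.2 htτ.le)
  refine ⟨τ, ⟨(hmem τ (right_mem_Icc.2 htτ.le)).1.1, ?_⟩, htτ, min_le_left _ _⟩
  simp only [Function.comp_apply] at hmvt
  calc ‖e (α τ) - e (α 0)‖ = ‖(e (α τ) - e (α t)) + (e (α t) - e (α 0))‖ := by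
        rw [sub_add_sub_cancel]
    _ ≤ ‖e (α τ) - e (α t)‖ + ‖e (α t) - e (α 0)‖ := norm_add_le _ _
    _ ≤ (G τ - G t) + G t := add_le_add hmvt htS.2
    _ = G τ := by ring

end Confinement

/-- In the bounds of `HasLagrangianBounds`, a curve of small velocity satisfying the Euler-Lagrange
equations is uniformly close to its tangent line. -/
theorem HasLagrangianBounds.norm_sub_sub_smul_le {E : Type*} [NormedAddCommGroup E]
    [NormedSpace ℝ E] {L : E → E → ℝ} {B : Set E} {lam K : ℝ}
    (hb : HasLagrangianBounds L B lam K) {U W : ℝ → E} {h w : ℝ}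
    (hU : ∀ τ ∈ Icc (0 : ℝ) 1, HasDerivWithinAt U (h • W τ) (Icc 0 1) τ)
    (hEL : ∀ τ ∈ Icc (0 : ℝ) 1, HasDerivWithinAt (fun τ => fderiv ℝ (L (U τ)) (W τ))
      (h • fderiv ℝ (fun p => L p (W τ)) (U τ)) (Icc 0 1) τ)
    (hUB : ∀ τ ∈ Icc (0 : ℝ) 1, U τ ∈ B) (hW : ∀ τ ∈ Icc (0 : ℝ) 1, ‖W τ‖ ≤ w) :
    ‖U 1 - U 0 - h • W 0‖ ≤ K / lam * (w * h) ^ 2 := by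
  have h0mem : (0 : ℝ) ∈ Icc (0 : ℝ) 1 := left_mem_Icc.2 zero_le_one
  have h1mem : (1 : ℝ) ∈ Icc (0 : ℝ) 1 := right_mem_Icc.2 zero_le_one
  have hK := hb.const_pos
  have hl := hb.lam_pos
  have hw0 : 0 ≤ w := (norm_nonneg _).trans (hW 0 h0mem)
  have hUU : ∀ τ ∈ Icc (0 : ℝ) 1, ‖U τ - U 0‖ ≤ |h| * w := by
    intro τ hτ
    have := norm_image_sub_le_of_norm_deriv_le_segment' hU (C := |h| * w)
      (fun r hr => by
        rw [norm_smul, Real.norm_eq_abs]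
        gcongr
        exact hW r (Ico_subset_Icc_self hr)) τ hτ
    refine this.trans ?_
    rw [sub_zero]
    exact mul_le_of_le_one_right (by positivity) hτ.2
  have hmm : ∀ τ ∈ Icc (0 : ℝ) 1,
      ‖fderiv ℝ (L (U τ)) (W τ) - fderiv ℝ (L (U 0)) (W 0)‖ ≤ |h| * (K * w ^ 2) := by
    intro τ hτ
    have := norm_image_sub_le_of_norm_deriv_le_segment' hEL (C := |h| * (K * w ^ 2))
      (fun r hr => by
        have hr' := Ico_subset_Icc_self hr
        rw [norm_smul, Real.norm_eq_abs]
        gcongr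
        refine (hb.base_bound _ (hUB r hr') _).trans ?_
        gcongr
        exact hW r hr') τ hτ
    refine this.trans ?_
    rw [sub_zero]
    exact mul_le_of_le_one_right (by positivity) hτ.2
  -- Momentum varies slowly by the Euler–Lagrange equation, and strong monotonicity of the Legendre
  -- map turns this into slow variation of velocity, without second derivatives of L.
  have hWW : ∀ τ ∈ Icc (0 : ℝ) 1, ‖W τ - W 0‖ ≤ K / lam * w ^ 2 * |h| := by
    intro τ hτ
    have h1 := hb.norm_sub_le (hUB 0 h0mem) (W 0) (W τ)
    have h2 : ‖fderiv ℝ (L (U τ)) (W τ) - fderiv ℝ (L (U 0)) (W τ)‖ ≤ K * w * (|h| * w) := by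
      refine (hb.fiber_lip _ (hUB 0 h0mem) _ (hUB τ hτ) (W τ)).trans ?_
      gcongr
      · exact hW τ hτ
      · exact hUU τ hτ
    have h3 : ‖fderiv ℝ (L (U 0)) (W τ) - fderiv ℝ (L (U 0)) (W 0)‖
        ≤ K * w * (|h| * w) + |h| * (K * w ^ 2) := by
      calc _ = ‖(fderiv ℝ (L (U τ)) (W τ) - fderiv ℝ (L (U 0)) (W 0))
            - (fderiv ℝ (L (U τ)) (W τ) - fderiv ℝ (L (U 0)) (W τ))‖ := by congr 1; abel
        _ ≤ _ := (_root_.norm_sub_le _ _).trans (by linarith [hmm τ hτ])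
    have h4 : K / lam * w ^ 2 * |h| = (K * w * (|h| * w) + |h| * (K * w ^ 2)) / (2 * lam) := by
      field_simp
      ring
    rw [h4, le_div_iff₀ (by positivity)]
    linarith
  have hfin := norm_image_sub_le_of_norm_deriv_le_segment_01'
    (f := fun τ => U τ - τ • (h • W 0)) (f' := fun τ => h • W τ - h • W 0)
    (C := |h| * (K / lam * w ^ 2 * |h|))
    (fun τ hτ => by
      simpa using (hU τ hτ).fun_sub ((hasDerivWithinAt_id τ _).smul_const (h • W 0)))
    (fun τ hτ => by
      rw [← smul_sub, norm_smul, Real.norm_eq_abs]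
      gcongr
      exact hWW τ (Ico_subset_Icc_self hτ))
  simp only [one_smul, zero_smul, sub_zero] at hfin
  calc ‖U 1 - U 0 - h • W 0‖ = ‖U 1 - h • W 0 - U 0‖ := by congr 1; abel
    _ ≤ _ := hfin
    _ = K / lam * w ^ 2 * |h| ^ 2 := by ring
    _ = _ := by rw [sq_abs]; ring

variable {n : ℕ} {M : Type*} [TopologicalSpace M] [ChartedSpace (EuclideanSpace ℝ (Fin n)) M]
  [IsManifold (𝓡 n) ∞ M] {F : TangentBundle (𝓡 n) M → ℝ}
  {e : OpenPartialHomeomorph M (EuclideanSpace ℝ (Fin n))}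

/-- The Euler–Lagrange equation says that (∂L/∂w)(u') has the same derivative as L along the curve.
By Euler's identity that quantity is 2L, so 2L' = L' and L' = 0. Non-zero velocity is needed for L
to be differentiable with the identity at hand. -/
theorem IsGeodesicOn.hasDerivWithinAt_energy (hF : IsFinslerMetric F) {c : ℝ → M} {a b : ℝ}
    (hab : a < b) (hc : IsGeodesicOn F c (Icc a b)) {t : ℝ} (ht : t ∈ Icc a b)
    (h0 : F (velocity c (Icc a b) t) ≠ 0) :
    HasDerivWithinAt (fun τ => (1 / 2) * F (velocity c (Icc a b) τ) ^ 2) 0 (Icc a b) t := by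
  set s := Icc a b with hs
  set e := chartAt (EuclideanSpace ℝ (Fin n)) (c t) with he_def
  have he : e ∈ atlas (EuclideanSpace ℝ (Fin n)) M := chart_mem_atlas _ _
  have hts : c t ∈ e.source := mem_chart_source _ _
  have hud : UniqueDiffOn ℝ s := uniqueDiffOn_Icc hab
  set u : ℝ → EuclideanSpace ℝ (Fin n) := e ∘ c with hu
  set u' := derivWithin u s with hu'
  have hu2 : ContDiffWithinAt ℝ 2 u s t := contDiffWithinAt_chart_comp he (WithTop.coe_le_coe.2 (le_top (a := (2 : ℕ∞)))) (hc.1 t ht) hts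
  have hu1 : HasDerivWithinAt u (u' t) s t :=
    (hu2.differentiableWithinAt (by simp)).hasDerivWithinAt
  have hu'1 : ContDiffWithinAt ℝ 1 u' s t := hu2.derivWithin hud (by norm_num) ht
  obtain ⟨u'', hu''⟩ : ∃ u'', HasDerivWithinAt u' u'' s t :=
    ⟨_, (hu'1.differentiableWithinAt (by simp)).hasDerivWithinAt⟩
  have hsrc : ∀ᶠ τ in 𝓝[s] t, c τ ∈ e.source :=
    (hc.1 t ht).continuousWithinAt (e.open_source.mem_nhds hts)
  have hmd : ∀ τ ∈ s, MDifferentiableWithinAt 𝓘(ℝ, ℝ) (𝓡 n) c s τ := fun τ hτ =>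
    (hc.1 τ hτ).mdifferentiableWithinAt (by simp)
  have hL := hF.isSmoothLagrangian he
  have hut : u t ∈ e.target := e.map_source hts
  have hu't : u' t ≠ 0 := by
    intro hz
    have h1 := chartLagrangian_velocity F he (hud t ht) (hmd t ht) hts
    change chartLagrangian F e (u t) (u' t) = _ at h1
    rw [hz, hL.eq_zero hut] at h1
    have : F (velocity c s t) ^ 2 = 0 := by linarith
    exact h0 (pow_eq_zero_iff two_ne_zero |>.1 this)
  set D := fderiv ℝ (fun z : EuclideanSpace ℝ (Fin n) × EuclideanSpace ℝ (Fin n) =>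
    chartLagrangian F e z.1 z.2) (u t, u' t) with hD
  have d1 : HasDerivWithinAt (fun τ => chartLagrangian F e (u τ) (u' τ)) (D (u' t, u'')) s t :=
    HasFDerivAt.comp_hasDerivWithinAt (f := fun τ => (u τ, u' τ))
      (l := fun z : EuclideanSpace ℝ (Fin n) × EuclideanSpace ℝ (Fin n) =>
        chartLagrangian F e z.1 z.2) t (hL.hasFDerivAt (z := (u t, u' t)) ⟨hut, hu't⟩)
      (hu1.prodMk hu'')
  have d2 := (hc.2 e he t ht hts).clm_apply hu''
  have hX : fderiv ℝ (fun p => chartLagrangian F e p (derivWithin (e ∘ c) s t)) (e (c t)) (u' t)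
      + fderiv ℝ (fun w => chartLagrangian F e (e (c t)) w) (derivWithin (e ∘ c) s t) u''
      = D (u' t, u'') := by
    have e1 : fderiv ℝ (fun p => chartLagrangian F e p (derivWithin (e ∘ c) s t)) (e (c t))
        = D.comp (ContinuousLinearMap.inl ℝ _ _) := (hL.hasFDerivAt_base hut hu't).fderiv
    have e2 : fderiv ℝ (fun w => chartLagrangian F e (e (c t)) w) (derivWithin (e ∘ c) s t)
        = D.comp (ContinuousLinearMap.inr ℝ _ _) := (hL.hasFDerivAt_fiber hut hu't).fderiv
    rw [e1, e2]
    simp only [ContinuousLinearMap.comp_apply, ContinuousLinearMap.inl_apply,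
      ContinuousLinearMap.inr_apply]
    rw [← map_add]
    simp
  rw [hX] at d2
  have hne : ∀ᶠ τ in 𝓝[s] t, u' τ ≠ 0 := hu''.continuousWithinAt.eventually_ne hu't
  have hEuler : ∀ᶠ τ in 𝓝[s] t, 2 * chartLagrangian F e (u τ) (u' τ)
      = fderiv ℝ (fun w => chartLagrangian F e (e (c τ)) w) (derivWithin (e ∘ c) s τ) (u' τ) := by
    filter_upwards [hsrc, hne] with τ h1 h2
    exact (hL.fderiv_fiber_self (e.map_source h1) h2).symm
  have d3 := (d1.const_mul 2)
  have d4 := d2.congr_of_eventuallyEq hEuler (hEuler.self_of_nhdsWithin ht)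
  have hzero : D (u' t, u'') = 0 := by
    have := (hud t ht).eq_deriv _ d3 d4
    linarith
  rw [hzero] at d1
  have hev : ∀ᶠ τ in 𝓝[s] t, (1 / 2) * F (velocity c s τ) ^ 2
      = chartLagrangian F e (u τ) (u' τ) := by
    filter_upwards [hsrc, self_mem_nhdsWithin] with τ h1 h2
    exact (chartLagrangian_velocity F he (hud τ h2) (hmd τ h2) h1).symm
  exact d1.congr_of_eventuallyEq hev (hev.self_of_nhdsWithin ht)

/-- Geodesics have constant speed. -/
theorem IsGeodesicOn.speed_eq (hF : IsFinslerMetric F) {c : ℝ → M} {a b : ℝ}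
    (hab : a < b) (hc : IsGeodesicOn F c (Icc a b)) {t t' : ℝ} (ht : t ∈ Icc a b)
    (ht' : t' ∈ Icc a b) :
    F (velocity c (Icc a b) t) = F (velocity c (Icc a b) t') := by
  have hcont := continuousOn_speed hF hab (hc.1.of_le (by norm_num))
  have key : ∀ r ∈ Icc a b, (1 / 2) * F (velocity c (Icc a b) r) ^ 2
      = (1 / 2) * F (velocity c (Icc a b) a) ^ 2 := fun r hr =>
    constant_of_hasDerivWithinAt_zero_of_ne_zero
      (f := fun r => (1 / 2) * F (velocity c (Icc a b) r) ^ 2) (fun r _ => by positivity)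
      (continuousOn_const.mul (hcont.pow 2))
      (fun r hr hne => hc.hasDerivWithinAt_energy hF hab hr (fun h => hne (by simp [h]))) hr
  have h1 := (key t ht).trans (key t' ht').symm
  have h2 : F (velocity c (Icc a b) t) ^ 2 = F (velocity c (Icc a b) t') ^ 2 := by linarith
  exact (pow_left_inj₀ (hF.nonneg _) (hF.nonneg _) two_ne_zero).1 h2

end Finsler

/-! ### Controlled charts and comparison of lengths. -/

namespace Finsler

variable {n : ℕ} {M : Type*} [TopologicalSpace M] [ChartedSpace (EuclideanSpace ℝ (Fin n)) M]
  {F : TangentBundle (𝓡 n) M → ℝ} {e : OpenPartialHomeomorph M (EuclideanSpace ℝ (Fin n))}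
  {y : EuclideanSpace ℝ (Fin n)} {R lam K : ℝ}

/-- The chart `e` contains the closed coordinate ball of centre `y` and radius `R`, and the Lagrangian
of `F` is uniformly controlled there. -/
structure IsControlledChart (F : TangentBundle (𝓡 n) M → ℝ)
    (e : OpenPartialHomeomorph M (EuclideanSpace ℝ (Fin n))) (y : EuclideanSpace ℝ (Fin n))
    (R lam K : ℝ) : Prop where
  mem_atlas : e ∈ atlas (EuclideanSpace ℝ (Fin n)) M
  closedBall_subset : Metric.closedBall y R ⊆ e.target
  bounds : HasLagrangianBounds (chartLagrangian F e) (Metric.closedBall y R) lam K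

theorem IsControlledChart.sqrt_pos (hC : IsControlledChart F e y R lam K) : 0 < √(2 * lam) :=
  Real.sqrt_pos.2 (by linarith [hC.bounds.lam_pos])

theorem length_eq_of_speed_eq {γ : ℝ → M} {ε : ℝ}
    (h : ∀ t ∈ Icc (0 : ℝ) 1, F (velocity γ (Icc 0 1) t) = ε) : length F γ = ε := by
  have : length F γ = ∫ _ in (0 : ℝ)..1, ε := intervalIntegral.integral_congr fun t ht => by
    rw [uIcc_of_le zero_le_one] at ht
    exact h t ht
  rw [this]
  simp

variable [IsManifold (𝓡 n) ∞ M]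

theorem IsFinslerMetric.exists_isControlledChart (hF : IsFinslerMetric F) (x : M) :
    ∃ R lam K : ℝ, 0 < R ∧ IsControlledChart F (chartAt (EuclideanSpace ℝ (Fin n)) x)
      (chartAt (EuclideanSpace ℝ (Fin n)) x x) R lam K := by
  set e := chartAt (EuclideanSpace ℝ (Fin n)) x
  have he : e ∈ atlas (EuclideanSpace ℝ (Fin n)) M := chart_mem_atlas _ _
  obtain ⟨R, hR, hsub⟩ := Metric.nhds_basis_closedBall.mem_iff.1
    (e.open_target.mem_nhds (e.map_source (mem_chart_source _ x)))
  obtain ⟨lam, K, hb⟩ := (hF.isSmoothLagrangian he).exists_hasLagrangianBounds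
    (isCompact_closedBall (e x) R) (convex_closedBall _ _) hsub
  exact ⟨R, lam, K, hR, he, hsub, hb⟩

/-- This and the next lemma compare F with the coordinate norm: lam‖w‖² ≤ F²/2 ≤ K‖w‖². -/
theorem IsControlledChart.norm_derivWithin_le (hC : IsControlledChart F e y R lam K)
    (hF : IsFinslerMetric F) {γ : ℝ → M} {s : Set ℝ} {t : ℝ} (hs : UniqueDiffWithinAt ℝ s t)
    (hγ : ContMDiffWithinAt 𝓘(ℝ, ℝ) (𝓡 n) 1 γ s t) (ht : γ t ∈ e.source)
    (hB : e (γ t) ∈ Metric.closedBall y R) :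
    ‖derivWithin (e ∘ γ) s t‖ ≤ F (velocity γ s t) / √(2 * lam) := by
  have h1 := chartLagrangian_velocity F hC.mem_atlas hs (hγ.mdifferentiableWithinAt (by simp)) ht
  have h2 := hC.bounds.lower hB (derivWithin (e ∘ γ) s t)
  have hl := hC.bounds.lam_pos
  rw [le_div_iff₀ hC.sqrt_pos]
  refine le_of_sq_le_sq ?_ (hF.nonneg _)
  rw [mul_pow, Real.sq_sqrt (by positivity)]
  linarith

theorem IsControlledChart.le_norm_derivWithin (hC : IsControlledChart F e y R lam K)
    {γ : ℝ → M} {s : Set ℝ} {t : ℝ} (hs : UniqueDiffWithinAt ℝ s t)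
    (hγ : ContMDiffWithinAt 𝓘(ℝ, ℝ) (𝓡 n) 1 γ s t) (ht : γ t ∈ e.source)
    (hB : e (γ t) ∈ Metric.closedBall y R) :
    F (velocity γ s t) ≤ √(2 * K) * ‖derivWithin (e ∘ γ) s t‖ := by
  have h1 := chartLagrangian_velocity F hC.mem_atlas hs (hγ.mdifferentiableWithinAt (by simp)) ht
  have h2 := hC.bounds.upper _ hB (derivWithin (e ∘ γ) s t)
  have hl := hC.bounds.const_pos
  refine le_of_sq_le_sq ?_ (by positivity)
  rw [mul_pow, Real.sq_sqrt (by positivity)]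
  linarith

theorem exists_continuous_speed (hF : IsFinslerMetric F) {γ : ℝ → M}
    (hγ : ContMDiffOn 𝓘(ℝ, ℝ) (𝓡 n) 1 γ (Icc 0 1)) :
    ∃ f : ℝ → ℝ, Continuous f ∧ (∀ t, 0 ≤ f t) ∧
      (∀ t ∈ Icc (0 : ℝ) 1, f t = F (velocity γ (Icc 0 1) t)) ∧
      ∫ t in (0 : ℝ)..1, f t = length F γ := by
  have hc := continuousOn_speed hF zero_lt_one hγ
  set f : ℝ → ℝ := IccExtend (zero_le_one' ℝ)
    ((Icc (0 : ℝ) 1).domRestrict fun t => F (velocity γ (Icc 0 1) t)) with hf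
  have hfe : ∀ t ∈ Icc (0 : ℝ) 1, f t = F (velocity γ (Icc 0 1) t) := fun t ht =>
    IccExtend_of_mem _ _ ht
  refine ⟨f, (continuousOn_iff_continuous_domRestrict.1 hc).Icc_extend', fun t => hF.nonneg _, hfe, ?_⟩
  refine intervalIntegral.integral_congr fun t ht => ?_
  rw [uIcc_of_le zero_le_one] at ht
  exact hfe t ht

theorem length_nonneg (hF : IsFinslerMetric F) (γ : ℝ → M) : 0 ≤ length F γ :=
  intervalIntegral.integral_nonneg zero_le_one fun _ _ => hF.nonneg _

theorem finslerDist_le_length (hF : IsFinslerMetric F) {γ : ℝ → M}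
    (hγ : ContMDiffOn 𝓘(ℝ, ℝ) (𝓡 n) 1 γ (Icc 0 1)) :
    finslerDist F (γ 0) (γ 1) ≤ length F γ := by
  refine csInf_le ⟨0, ?_⟩ ⟨γ, hγ, rfl, rfl, rfl⟩
  rintro _ ⟨γ, -, -, -, rfl⟩
  exact length_nonneg hF γ

/-- Two points of a coordinate ball are joined by a `C¹` curve. -/
theorem exists_curve (he : e ∈ atlas (EuclideanSpace ℝ (Fin n)) M)
    (hR : Metric.closedBall y R ⊆ e.target) {x z : M} (hx : x ∈ e.source) (hz : z ∈ e.source)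
    (hxB : e x ∈ Metric.closedBall y R) (hzB : e z ∈ Metric.closedBall y R) :
    ∃ γ : ℝ → M, ContMDiffOn 𝓘(ℝ, ℝ) (𝓡 n) 1 γ (Icc 0 1) ∧ γ 0 = x ∧ γ 1 = z := by
  have h1 : ContMDiffOn (𝓡 n) (𝓡 n) ∞ e.symm e.target :=
    contMDiffOn_symm_of_mem_maximalAtlas (IsManifold.subset_maximalAtlas he)
  have h2 : ContDiff ℝ 1 (fun t : ℝ => e x + t • (e z - e x)) := by fun_prop
  refine ⟨fun t => e.symm (e x + t • (e z - e x)), ?_, by simp [hx], by simp [hz]⟩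
  refine (h1.of_le (by simp)).comp h2.contMDiff.contMDiffOn fun t ht => hR ?_
  exact (convex_closedBall y R).add_smul_sub_mem hxB hzB ht

variable [T2Space M]

/-- A short curve stays in the chart. -/
theorem IsControlledChart.curve_mem (hC : IsControlledChart F e y R lam K) (hF : IsFinslerMetric F)
    {α : ℝ → M} (hα : ContMDiffOn 𝓘(ℝ, ℝ) (𝓡 n) 1 α (Icc 0 1)) (hα0 : α 0 ∈ e.source)
    (hlt : ‖e (α 0) - y‖ + length F α / √(2 * lam) < R) :
    ∀ t ∈ Icc (0 : ℝ) 1, α t ∈ e.source ∧ ‖e (α t) - e (α 0)‖ ≤ length F α / √(2 * lam) := by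
  obtain ⟨f, hfc, hf0, hfe, hfl⟩ := exists_continuous_speed hF hα
  have hk := hC.sqrt_pos
  have hmain := mem_source_and_norm_sub_le e hC.closedBall_subset
    (u' := derivWithin (e ∘ α) (Icc 0 1)) (g := fun t => f t / √(2 * lam))
    (G := fun t => (∫ τ in (0 : ℝ)..t, f τ) / √(2 * lam)) hα.continuousOn hα0
    (fun t => (hfc.integral_hasStrictDerivAt 0 t).hasDerivAt.div_const _) (by simp)
    (fun t _ => div_nonneg (hf0 t) hk.le)
    (fun t ht hts htB => ⟨hasDerivWithinAt_chart_comp hC.mem_atlas (hα t ht) hts, by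
      rw [hfe t ht]
      exact hC.norm_derivWithin_le hF (uniqueDiffOn_Icc zero_lt_one t ht) (hα t ht) hts htB⟩)
    (by rw [hfl]; exact hlt)
  intro t ht
  refine ⟨(hmain t ht).1, (hmain t ht).2.trans ?_⟩
  rw [← hfl]
  gcongr
  exact intervalIntegral.integral_mono_interval le_rfl ht.1 ht.2
    (Eventually.of_forall hf0) (hfc.intervalIntegrable _ _)

/-- Comparison of the length of a curve issuing from `x` with that of a short geodesic issuing
from `x`. -/
theorem IsControlledChart.length_comparison {x : M} (hC : IsControlledChart F e (e x) R lam K)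
    (hF : IsFinslerMetric F) (hx : x ∈ e.source) {ε : ℝ} (hε : 0 < ε)
    (h1 : ε / √(2 * lam) ≤ 1) (hR : 4 * (ε / √(2 * lam)) ≤ R)
    (hK : 96 * K * (ε / √(2 * lam)) ≤ lam) {γ α : ℝ → M} (hγ : IsGeodesicOn F γ (Icc 0 1))
    (hγ0 : γ 0 = x) (hγε : ∀ t ∈ Icc (0 : ℝ) 1, F (velocity γ (Icc 0 1) t) = ε)
    (hα : ContMDiffOn 𝓘(ℝ, ℝ) (𝓡 n) 1 α (Icc 0 1)) (hα0 : α 0 = x)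
    (hαl : length F α ≤ 2 * ε) :
    (1 / 2) * ε ^ 2 + fderiv ℝ (chartLagrangian F e (e (γ 1))) (derivWithin (e ∘ γ) (Icc 0 1) 1)
        (e (α 1) - e (γ 1)) + lam / 16 * ‖e (α 1) - e (γ 1)‖ ^ 2
      ≤ (1 / 2) * length F α ^ 2 := by
  have hk := hC.sqrt_pos
  have hud : UniqueDiffOn ℝ (Icc (0 : ℝ) 1) := uniqueDiffOn_Icc zero_lt_one
  have hγ1 : ContMDiffOn 𝓘(ℝ, ℝ) (𝓡 n) 1 γ (Icc 0 1) := hγ.1.of_le (by norm_num)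
  have hγl : length F γ = ε := length_eq_of_speed_eq hγε
  set r := ε / √(2 * lam) with hr
  have hr0 : 0 < r := by positivity
  have hK0 := hC.bounds.const_pos
  have hαl' : length F α / √(2 * lam) ≤ 2 * r := by
    rw [hr, ← mul_div_assoc]
    gcongr
  have hγm := hC.curve_mem hF hγ1 (by rwa [hγ0]) (by
    rw [hγ0, hγl, sub_self, norm_zero, zero_add, ← hr]; linarith)
  have hαm := hC.curve_mem hF hα (by rwa [hα0]) (by
    rw [hα0, sub_self, norm_zero, zero_add]; linarith)
  rw [hγ0, hγl, ← hr] at hγm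
  rw [hα0] at hαm
  have hγB : ∀ t ∈ Icc (0 : ℝ) 1, e (γ t) ∈ Metric.closedBall (e x) R := fun t ht => by
    rw [mem_closedBall_iff_norm]
    linarith [(hγm t ht).2]
  have hαB : ∀ t ∈ Icc (0 : ℝ) 1, e (α t) ∈ Metric.closedBall (e x) R := fun t ht => by
    rw [mem_closedBall_iff_norm]
    linarith [(hαm t ht).2]
  obtain ⟨f, hfc, hf0, hfe, hfl⟩ := exists_continuous_speed hF hα
  rw [← hfl]
  -- With r = ε/√(2 lam), γ stays within r of x and α within 2r, hence δ = 3r. As r² ≤ r, the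
  -- smallness conditions become 22Kr ≤ lam/2 and 3Kr ≤ lam/32; the second is the hypothesis with
  -- 96.
  refine hC.bounds.energy_comparison
    (fun p hp => (hF.isSmoothLagrangian hC.mem_atlas).homogeneous p (hC.closedBall_subset hp))
    (γ := e ∘ γ) (γ' := derivWithin (e ∘ γ) (Icc 0 1)) (α := e ∘ α)
    (α' := derivWithin (e ∘ α) (Icc 0 1)) (g := r) (δ := 3 * r)
    (fun t ht => hasDerivWithinAt_chart_comp hC.mem_atlas (hγ1 t ht) (hγm t ht).1)
    (fun t ht => hγ.2 e hC.mem_atlas t ht (hγm t ht).1) hγB ?_ ?_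
    (fun t ht => hasDerivWithinAt_chart_comp hC.mem_atlas (hα t ht) (hαm t ht).1) hαB hfc
    (fun t _ => hf0 t) ?_ (by simp [hα0, hγ0]) ?_ ?_ ?_
  · intro t ht
    rw [← hγε t ht]
    exact chartLagrangian_velocity F hC.mem_atlas (hud t ht)
      ((hγ1 t ht).mdifferentiableWithinAt (by simp)) (hγm t ht).1
  · intro t ht
    rw [hr, ← hγε t ht]
    exact hC.norm_derivWithin_le hF (hud t ht) (hγ1 t ht) (hγm t ht).1 (hγB t ht)
  · intro t ht
    rw [hfe t ht]
    exact chartLagrangian_velocity F hC.mem_atlas (hud t ht)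
      ((hα t ht).mdifferentiableWithinAt (by simp)) (hαm t ht).1
  · intro t ht s hs
    calc ‖e (α t) - e (γ s)‖ = ‖(e (α t) - e x) - (e (γ s) - e x)‖ := by
          rw [sub_sub_sub_cancel_right]
      _ ≤ ‖e (α t) - e x‖ + ‖e (γ s) - e x‖ := norm_sub_le _ _
      _ ≤ 3 * r := by linarith [(hαm t ht).2, (hγm s hs).2]
  · have : r ^ 2 ≤ r := by nlinarith
    nlinarith [mul_le_mul_of_nonneg_left this hK0.le]
  · have : r ^ 2 ≤ r := by nlinarith
    nlinarith [mul_le_mul_of_nonneg_left this hK0.le]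

end Finsler

/-! ### Small geodesic spheres: tangency and strict convexity. -/

namespace Finsler

variable {n : ℕ} {M : Type*} [TopologicalSpace M] [ChartedSpace (EuclideanSpace ℝ (Fin n)) M]
  [IsManifold (𝓡 n) ∞ M] {F : TangentBundle (𝓡 n) M → ℝ}
  {e : OpenPartialHomeomorph M (EuclideanSpace ℝ (Fin n))} {R lam K : ℝ} {x : M} {ε : ℝ}

/-- The radial geodesic to a point of a geodesic sphere. -/
theorem exists_radial_geodesic (hF : IsFinslerMetric F) {z : M} (hz : z ∈ geodesicSphere F x ε) :
    ∃ γ : ℝ → M, IsGeodesicOn F γ (Icc 0 1) ∧ γ 0 = x ∧ γ 1 = z ∧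
      ∀ t ∈ Icc (0 : ℝ) 1, F (velocity γ (Icc 0 1) t) = ε := by
  obtain ⟨X, hX, γ, hγ, hγv, hγ1⟩ := hz
  refine ⟨γ, hγ, congrArg Bundle.TotalSpace.proj hγv, hγ1, fun t ht => ?_⟩
  rw [hγ.speed_eq hF zero_lt_one ht (left_mem_Icc.2 zero_le_one), hγv, hX]

variable [T2Space M]

/-- The momentum of a radial geodesic annihilates the tangent vectors of the geodesic sphere. -/
theorem IsControlledChart.momentum_tangent_eq_zero (hC : IsControlledChart F e (e x) R lam K)
    (hF : IsFinslerMetric F) (hx : x ∈ e.source) (hε : 0 < ε)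
    (h1 : ε / √(2 * lam) ≤ 1) (hR : 4 * (ε / √(2 * lam)) ≤ R)
    (hK : 96 * K * (ε / √(2 * lam)) ≤ lam) {γ : ℝ → M} (hγ : IsGeodesicOn F γ (Icc 0 1))
    (hγ0 : γ 0 = x) (hγε : ∀ t ∈ Icc (0 : ℝ) 1, F (velocity γ (Icc 0 1) t) = ε)
    {c : ℝ → M} {s : Set ℝ} {t : ℝ} (hs : UniqueDiffWithinAt ℝ s t)
    (hc : ContMDiffWithinAt 𝓘(ℝ, ℝ) (𝓡 n) 1 c s t) (hct : c t = γ 1) (hts : c t ∈ e.source)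
    (htan : IsTangentTo (geodesicSphere F x ε) (velocity (n := n) c s t)) :
    fderiv ℝ (chartLagrangian F e (e (γ 1))) (derivWithin (e ∘ γ) (Icc 0 1) 1)
      (derivWithin (e ∘ c) s t) = 0 := by
  obtain ⟨σ, hσ, hσS, hσv⟩ := htan
  have hσ0 : σ 0 = c t := congrArg Bundle.TotalSpace.proj hσv
  have hσ0s : σ 0 ∈ e.source := hσ0 ▸ hts
  set p := fderiv ℝ (chartLagrangian F e (e (γ 1))) (derivWithin (e ∘ γ) (Icc 0 1) 1) with hp
  have hder : derivWithin (e ∘ σ) univ 0 = derivWithin (e ∘ c) s t := by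
    rw [derivWithin_chart_comp hC.mem_atlas uniqueDiffWithinAt_univ
      (hσ.mdifferentiableAt (by simp)).mdifferentiableWithinAt hσ0s,
      derivWithin_chart_comp hC.mem_atlas hs (hc.mdifferentiableWithinAt (by simp)) hts]
    exact congrArg (fun v : TangentBundle (𝓡 n) M =>
      (mfderiv (𝓡 n) (𝓡 n) e v.1 v.2 : EuclideanSpace ℝ (Fin n))) hσv
  have hd : HasDerivAt (e ∘ σ) (derivWithin (e ∘ c) s t) 0 := by
    rw [← hder, ← hasDerivWithinAt_univ]
    exact hasDerivWithinAt_chart_comp hC.mem_atlas hσ.contMDiffWithinAt hσ0s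
  have hpd : HasDerivAt (fun r => p (e (σ r))) (p (derivWithin (e ∘ c) s t)) 0 :=
    p.hasFDerivAt.comp_hasDerivAt 0 hd
  -- Each nearby σ(r) is the end of a radial geodesic of the same length ε, so the comparison leaves
  -- p(e(σ r) − e(γ 1)) ≤ 0, with equality at r = 0.
  refine IsLocalMax.hasDerivAt_eq_zero (f := fun r => p (e (σ r))) ?_ hpd
  filter_upwards [hσS] with r hr
  obtain ⟨α, hα, hα0, hα1, hαε⟩ := exists_radial_geodesic hF hr
  have hl : length F α = ε := length_eq_of_speed_eq hαε
  have hmain := hC.length_comparison hF hx hε h1 hR hK hγ hγ0 hγε (hα.1.of_le (by norm_num)) hα0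
    (by linarith)
  rw [hl, hα1, map_sub] at hmain
  have hpos : 0 ≤ lam / 16 * ‖e (σ r) - e (γ 1)‖ ^ 2 := by
    have := hC.bounds.lam_pos
    positivity
  simp only [hσ0, hct]
  linarith

/-- A geodesic starting in a small coordinate ball stays in the chart for a short time and is close to
its tangent line. -/
theorem IsControlledChart.geodesic_expansion {y : EuclideanSpace ℝ (Fin n)}
    (hC : IsControlledChart F e y R lam K)
    (hF : IsFinslerMetric F) {c : ℝ → M} {a b : ℝ} (hab : a < b) (hc : IsGeodesicOn F c (Icc a b))
    {t₀ t : ℝ} (ht₀ : t₀ ∈ Icc a b) (ht : t ∈ Icc a b) (hsrc : c t₀ ∈ e.source)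
    (hlt : ‖e (c t₀) - y‖ + F (velocity c (Icc a b) t₀) * |t - t₀| / √(2 * lam) < R) :
    c t ∈ e.source ∧ e (c t) ∈ Metric.closedBall y R ∧
      ‖e (c t) - e (c t₀) - (t - t₀) • derivWithin (e ∘ c) (Icc a b) t₀‖
        ≤ K / lam * (F (velocity c (Icc a b) t₀) / √(2 * lam) * (t - t₀)) ^ 2 := by
  set v := F (velocity c (Icc a b) t₀) with hv
  set h := t - t₀ with hh
  set k := √(2 * lam) with hk
  have hk0 : 0 < k := hC.sqrt_pos
  have hv0 : 0 ≤ v := hF.nonneg _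
  have hud : UniqueDiffOn ℝ (Icc a b) := uniqueDiffOn_Icc hab
  have hc1 : ContMDiffOn 𝓘(ℝ, ℝ) (𝓡 n) 1 c (Icc a b) := hc.1.of_le (by norm_num)
  -- The affine parameter τ runs over [0,1] from t₀ to t; since h may be negative, both time
  -- directions are treated together.
  have hmaps : MapsTo (fun τ : ℝ => t₀ + τ * h) (Icc 0 1) (Icc a b) := fun τ hτ => by
    have := (convex_Icc a b).add_smul_sub_mem ht₀ ht hτ
    simpa using this
  have hline : ∀ τ : ℝ, HasDerivWithinAt (fun τ : ℝ => t₀ + τ * h) h (Icc 0 1) τ := fun τ => by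
    simpa using ((hasDerivWithinAt_id τ (Icc 0 1)).mul_const h).const_add t₀
  have hcont : ContinuousOn (fun τ : ℝ => c (t₀ + τ * h)) (Icc 0 1) :=
    hc1.continuousOn.comp (fun τ _ => (hline τ).continuousWithinAt) hmaps
  set W : ℝ → EuclideanSpace ℝ (Fin n) := fun τ => derivWithin (e ∘ c) (Icc a b) (t₀ + τ * h)
    with hW
  have hder : ∀ τ ∈ Icc (0 : ℝ) 1, c (t₀ + τ * h) ∈ e.source →
      HasDerivWithinAt (fun τ => e (c (t₀ + τ * h))) (h • W τ) (Icc 0 1) τ := fun τ hτ hs =>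
    HasDerivWithinAt.scomp τ (hasDerivWithinAt_chart_comp hC.mem_atlas (hc1 _ (hmaps hτ)) hs)
      (hline τ) hmaps
  have hWb : ∀ τ ∈ Icc (0 : ℝ) 1, c (t₀ + τ * h) ∈ e.source →
      e (c (t₀ + τ * h)) ∈ Metric.closedBall y R → ‖W τ‖ ≤ v / k := fun τ hτ hs hB => by
    rw [hv, hc.speed_eq hF hab ht₀ (hmaps hτ)]
    exact hC.norm_derivWithin_le hF (hud _ (hmaps hτ)) (hc1 _ (hmaps hτ)) hs hB
  have hconf := mem_source_and_norm_sub_le e hC.closedBall_subset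
    (α := fun τ => c (t₀ + τ * h)) (u' := fun τ => h • W τ) (g := fun _ => v * |h| / k)
    (G := fun τ => v * |h| / k * τ) hcont (by simpa using hsrc)
    (fun τ => by simpa using (hasDerivAt_id τ).const_mul (v * |h| / k)) (by simp)
    (fun τ _ => by positivity)
    (fun τ hτ hs hB => ⟨hder τ hτ hs, by
      rw [norm_smul, Real.norm_eq_abs]
      calc |h| * ‖W τ‖ ≤ |h| * (v / k) := by gcongr; exact hWb τ hτ hs hB
        _ = v * |h| / k := by ring⟩)
    (by simpa using hlt)
  have hB : ∀ τ ∈ Icc (0 : ℝ) 1, e (c (t₀ + τ * h)) ∈ Metric.closedBall y R := fun τ hτ => by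
    have h2 := (hconf τ hτ).2
    simp only [zero_mul, add_zero] at h2
    have h3 : v * |h| / k * τ ≤ v * |h| / k := mul_le_of_le_one_right (by positivity) hτ.2
    rw [mem_closedBall_iff_norm]
    calc ‖e (c (t₀ + τ * h)) - y‖ = ‖(e (c (t₀ + τ * h)) - e (c t₀)) + (e (c t₀) - y)‖ := by
          rw [sub_add_sub_cancel]
      _ ≤ ‖e (c (t₀ + τ * h)) - e (c t₀)‖ + ‖e (c t₀) - y‖ := norm_add_le _ _
      _ ≤ R := by linarith
  have h1mem : (1 : ℝ) ∈ Icc (0 : ℝ) 1 := right_mem_Icc.2 zero_le_one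
  have ht1 : t₀ + 1 * h = t := by rw [hh]; ring
  have hexp := hC.bounds.norm_sub_sub_smul_le (U := fun τ => e (c (t₀ + τ * h))) (W := W) (h := h)
    (w := v / k) (fun τ hτ => hder τ hτ (hconf τ hτ).1)
    (fun τ hτ => HasDerivWithinAt.scomp τ
      (hc.2 e hC.mem_atlas _ (hmaps hτ) (hconf τ hτ).1) (hline τ) hmaps)
    hB (fun τ hτ => hWb τ hτ (hconf τ hτ).1 (hB τ hτ))
  have e1 := (hconf 1 h1mem).1
  have e2 := hB 1 h1mem
  simp only [ht1, hW, zero_mul, add_zero] at e1 e2 hexp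
  exact ⟨e1, e2, hexp⟩

set_option maxHeartbeats 800000 in
/-- The distance to `x` along a geodesic touching a small geodesic sphere grows at least
quadratically. -/
theorem IsControlledChart.exists_strict_convexity (hC : IsControlledChart F e (e x) R lam K)
    (hF : IsFinslerMetric F) (hx : x ∈ e.source) (hε : 0 < ε)
    (h1 : ε / √(2 * lam) ≤ 1) (hR : 4 * (ε / √(2 * lam)) ≤ R)
    (hK : 96 * K * (ε / √(2 * lam)) ≤ lam) (hε1 : ε ≤ lam / (512 * K))
    (hε2 : K ^ 2 / (2 * lam ^ 2 * √(2 * lam)) * ε ≤ lam / (256 * K)) :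
    ∃ ρ : ℝ, 0 < ρ ∧ ∀ μ : ℝ, μ ≤ 1 → ∀ (a b : ℝ) (c : ℝ → M), IsGeodesicOn F c (Icc a b) →
      ∀ t₀ ∈ Ioo a b, c t₀ ∈ geodesicSphere F x ε →
        IsTangentTo (geodesicSphere F x ε) (velocity (n := n) c (Icc a b) t₀) →
        ∀ t ∈ Icc a b, F (velocity c (Icc a b) t₀) * |t - t₀| ≤ ρ →
          finslerDist F x (c t₀) + μ * (F (velocity c (Icc a b) t₀) * (t - t₀)) ^ 2
            ≤ finslerDist F x (c t) := by
  set k := √(2 * lam) with hk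
  have hk0 : 0 < k := hC.sqrt_pos
  have hl0 := hC.bounds.lam_pos
  have hK0 := hC.bounds.const_pos
  have hk2 : k ^ 2 = 2 * lam := Real.sq_sqrt (by positivity)
  set k' := √(2 * K) with hk'
  have hk'0 : 0 < k' := Real.sqrt_pos.2 (by positivity)
  have hk'2 : k' ^ 2 = 2 * K := Real.sq_sqrt (by positivity)
  set C := K / (2 * lam ^ 2) with hCdef
  have hC0 : 0 < C := by positivity
  set κ := lam / (128 * K) with hκ
  have hκ0 : 0 < κ := by positivity
  -- The bound ε keeps c(t) in the ball and settles the case of long curves; 1/(2k'C) makes the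
  -- expansion error at most half the linear term; 1 and κ/2 give s² ≤ ρ ≤ κ/2. No bound involves μ.
  set ρ := min (min ε 1) (min (1 / (2 * k' * C)) (κ / 2)) with hρ
  have hρ0 : 0 < ρ := by
    refine lt_min (lt_min hε one_pos) (lt_min ?_ ?_) <;> positivity
  have hρε : ρ ≤ ε := (min_le_left _ _).trans (min_le_left _ _)
  have hρ1 : ρ ≤ 1 := (min_le_left _ _).trans (min_le_right _ _)
  have hρC : ρ ≤ 1 / (2 * k' * C) := (min_le_right _ _).trans (min_le_left _ _)
  have hρκ : ρ ≤ κ / 2 := (min_le_right _ _).trans (min_le_right _ _)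
  refine ⟨ρ, hρ0, fun μ hμ a b c hc t₀ ht₀ hct₀ htan t ht hvt => ?_⟩
  have hab : a < b := ht₀.1.trans ht₀.2
  have ht₀' : t₀ ∈ Icc a b := Ioo_subset_Icc_self ht₀
  have hud : UniqueDiffOn ℝ (Icc a b) := uniqueDiffOn_Icc hab
  have hc1 : ContMDiffOn 𝓘(ℝ, ℝ) (𝓡 n) 1 c (Icc a b) := hc.1.of_le (by norm_num)
  obtain ⟨γ, hγ, hγ0, hγ1, hγε⟩ := exists_radial_geodesic hF hct₀
  have hγC1 : ContMDiffOn 𝓘(ℝ, ℝ) (𝓡 n) 1 γ (Icc 0 1) := hγ.1.of_le (by norm_num)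
  have hγl : length F γ = ε := length_eq_of_speed_eq hγε
  have h1mem : (1 : ℝ) ∈ Icc (0 : ℝ) 1 := right_mem_Icc.2 zero_le_one
  have hr0 : 0 < ε / k := by positivity
  obtain ⟨hsrc, hdist⟩ := hC.curve_mem hF hγC1 (by rwa [hγ0]) (by
    rw [hγ0, hγl, sub_self, norm_zero, zero_add, ← hk]; linarith) 1 h1mem
  rw [hγ1] at hsrc hdist
  rw [hγ0, hγl, ← hk] at hdist
  set v := F (velocity c (Icc a b) t₀) with hv
  have hv0 : 0 ≤ v := hF.nonneg _
  set s := v * |t - t₀| with hs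
  have hs0 : 0 ≤ s := by positivity
  have hs2 : (v * (t - t₀)) ^ 2 = s ^ 2 := by rw [hs, mul_pow, mul_pow, sq_abs]
  clear_value s
  rw [hs2]
  have hrad : s / k ≤ ε / k := by
    gcongr
    exact hvt.trans hρε
  obtain ⟨htsrc, htB, hexp⟩ := hC.geodesic_expansion hF hab hc ht₀' ht hsrc (by
    rw [← hk, ← hv, ← hs]; linarith)
  rw [← hv, ← hk] at hexp
  have hCs : K / lam * (v / k * (t - t₀)) ^ 2 = C * s ^ 2 := by
    rw [← hs2, hCdef, mul_pow, div_pow, hk2, mul_pow]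
    field_simp
  rw [hCs] at hexp
  set w := derivWithin (e ∘ c) (Icc a b) t₀ with hw
  set ξ := e (c t) - e (c t₀) with hξ
  have htanw := hC.momentum_tangent_eq_zero hF hx hε h1 hR hK hγ hγ0 hγε (hud _ ht₀')
    (hc1 _ ht₀') hγ1.symm hsrc htan
  set p := fderiv ℝ (chartLagrangian F e (e (γ 1))) (derivWithin (e ∘ γ) (Icc 0 1) 1) with hp
  have hball : e (c t₀) ∈ Metric.closedBall (e x) R := by
    rw [mem_closedBall_iff_norm]; linarith
  have hpnorm : ‖p‖ ≤ K * (ε / k) := by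
    refine (hC.bounds.fiber_bound _ (by rwa [hγ1]) _).trans ?_
    gcongr
    rw [← hγε 1 h1mem]
    exact hC.norm_derivWithin_le hF (uniqueDiffOn_Icc zero_lt_one 1 h1mem) (hγC1 1 h1mem)
      (by rwa [hγ1]) (by rwa [hγ1])
  -- Only the quadratic error of the expansion contributes, since p kills the tangent vector; `hε2`
  -- makes the cost at most half of the gain κs² found in `hquad`.
  have hpξ : -(κ / 2 * s ^ 2) ≤ p ξ := by
    have e1 : p ξ = p (ξ - (t - t₀) • w) := by
      rw [map_sub p ξ, map_smul, htanw, smul_zero, sub_zero]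
    have e2 := p.le_of_opNorm_le hpnorm (ξ - (t - t₀) • w)
    rw [e1]
    refine neg_le_of_abs_le (e2.trans ?_)
    calc K * (ε / k) * ‖ξ - (t - t₀) • w‖ ≤ K * (ε / k) * (C * s ^ 2) := by gcongr
      _ = (K ^ 2 / (2 * lam ^ 2 * k) * ε) * s ^ 2 := by rw [hCdef]; field_simp
      _ ≤ lam / (256 * K) * s ^ 2 := by gcongr
      _ = κ / 2 * s ^ 2 := by rw [hκ]; field_simp; ring
  have hξlow : s / (2 * k') ≤ ‖ξ‖ := by
    have e1 : v ≤ k' * ‖w‖ := hC.le_norm_derivWithin (hud _ ht₀') (hc1 _ ht₀') hsrc hball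
    have e2 : s / k' ≤ ‖(t - t₀) • w‖ := by
      rw [norm_smul, Real.norm_eq_abs, div_le_iff₀ hk'0, hs]
      nlinarith [abs_nonneg (t - t₀)]
    have e3 : ‖(t - t₀) • w‖ ≤ ‖ξ‖ + C * s ^ 2 := by
      calc ‖(t - t₀) • w‖ = ‖ξ - (ξ - (t - t₀) • w)‖ := by rw [sub_sub_cancel]
        _ ≤ _ := (norm_sub_le _ _).trans (by gcongr)
    have e4 : C * s ^ 2 ≤ s / (2 * k') := by
      have : C * s ≤ C * (1 / (2 * k' * C)) := by gcongr; exact hvt.trans hρC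
      calc C * s ^ 2 = C * s * s := by ring
        _ ≤ C * (1 / (2 * k' * C)) * s := by gcongr
        _ = _ := by field_simp
    have e5 : s / k' = s / (2 * k') + s / (2 * k') := by field_simp; norm_num
    linarith
  have hquad : κ * s ^ 2 ≤ lam / 16 * ‖ξ‖ ^ 2 := by
    calc κ * s ^ 2 = lam / 16 * (s / (2 * k')) ^ 2 := by
          rw [div_pow, mul_pow, hk'2, hκ]; field_simp; ring
      _ ≤ _ := by gcongr
  have hsρ : s ^ 2 ≤ ρ := by
    calc s ^ 2 = s * s := sq s
      _ ≤ ρ * 1 := mul_le_mul hvt (hvt.trans hρ1) hs0 hρ0.le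
      _ = ρ := mul_one ρ
  have hd0 : finslerDist F x (c t₀) ≤ ε := by
    have := finslerDist_le_length hF hγC1
    rwa [hγ0, hγ1, hγl] at this
  have hμs : μ * s ^ 2 ≤ s ^ 2 := mul_le_of_le_one_left (by positivity) hμ
  have hmain : ε + s ^ 2 ≤ finslerDist F x (c t) := by
    -- A competing curve must exist, because the infimum of an empty set of reals is 0 by
    -- convention.
    obtain ⟨β, hβ, hβ0, hβ1⟩ := exists_curve hC.mem_atlas hC.closedBall_subset hx htsrc
      (Metric.mem_closedBall_self (by linarith)) htB
    refine le_csInf ⟨_, β, hβ, hβ0, hβ1, rfl⟩ ?_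
    rintro _ ⟨α, hα, hα0, hα1, rfl⟩
    by_cases hlong : length F α ≤ 2 * ε
    · have hcmp := hC.length_comparison hF hx hε h1 hR hK hγ hγ0 hγε hα hα0 hlong
      rw [hα1, ← hp, hγ1, ← hξ] at hcmp
      -- The comparison gives ε² + κs² ≤ ℓ², and (ε + s²)² = ε² + (2ε + s²)s² with 2ε ≤ κ/2 and s² ≤
      -- κ/2.
      refine le_of_sq_le_sq ?_ (length_nonneg hF α)
      have e1 : 2 * ε + s ^ 2 ≤ κ := by
        have : ε ≤ κ / 4 := hε1.trans_eq (by rw [hκ]; field_simp; norm_num)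
        linarith
      have e2 := mul_le_mul_of_nonneg_right e1 (sq_nonneg s)
      have e3 : (ε + s ^ 2) ^ 2 = ε ^ 2 + (2 * ε + s ^ 2) * s ^ 2 := by ring
      linarith
    · linarith
  linarith

end Finsler

theorem proposition2p9 {n : ℕ} {M : Type*} [TopologicalSpace M] [T2Space M]
    [ChartedSpace (EuclideanSpace ℝ (Fin n)) M] [IsManifold (𝓡 n) ∞ M]
    (F : TangentBundle (𝓡 n) M → ℝ) (hF : Finsler.IsFinslerMetric F) (x : M)
    (η : ℝ) (hη : 0 < η) :
    ∃ ε₀ : ℝ, 0 < ε₀ ∧ ε₀ < η ∧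
      ∀ ε : ℝ, 0 < ε → ε < ε₀ → ∀ μ : ℝ, 0 < μ → μ < 1 →
        ∃ ρ : ℝ, 0 < ρ ∧
          ∀ (a : ℝ) (c : ℝ → M), 0 < a → Finsler.IsGeodesicOn F c (Icc 0 a) →
            (∃ t ∈ Icc 0 a, c t ≠ c 0) →
            ∀ t₀ ∈ Ioo 0 a, c t₀ ∈ Finsler.geodesicSphere F x ε →
              Finsler.IsTangentTo (Finsler.geodesicSphere F x ε)
                (Finsler.velocity (n := n) c (Icc 0 a) t₀) →
              ∀ t ∈ Icc 0 a, F (Finsler.velocity (n := n) c (Icc 0 a) t₀) * |t - t₀| ≤ ρ →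
                Finsler.finslerDist F x (c t₀)
                    + μ * (F (Finsler.velocity (n := n) c (Icc 0 a) t₀) * (t - t₀)) ^ 2
                  ≤ Finsler.finslerDist F x (c t) := by
  obtain ⟨R, lam, K, hR, hC⟩ := hF.exists_isControlledChart x
  have hl0 := hC.bounds.lam_pos
  have hK0 := hC.bounds.const_pos
  have hsmall : ∀ A B : ℝ, 0 < B → ∀ᶠ ε in 𝓝[>] (0 : ℝ), A * ε < B := fun A B hB => by
    have h : Tendsto (fun ε : ℝ => A * ε) (𝓝[>] 0) (𝓝 (A * 0)) :=
      ((continuous_const.mul continuous_id).tendsto 0).mono_left nhdsWithin_le_nhds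
    rw [mul_zero] at h
    exact h.eventually (gt_mem_nhds hB)
  -- All smallness conditions on ε are linear with constants depending only on the chart, so they
  -- hold for all small ε > 0.
  have hev := (((hsmall (1 / √(2 * lam)) 1 one_pos).and (hsmall (4 / √(2 * lam)) R hR)).and
    ((hsmall (96 * K / √(2 * lam)) lam hl0).and
      (hsmall 1 (lam / (512 * K)) (by positivity)))).and
    (hsmall (K ^ 2 / (2 * lam ^ 2 * √(2 * lam))) (lam / (256 * K)) (by positivity))
  obtain ⟨δ, hδ, hδsub⟩ := (mem_nhdsGT_iff_exists_Ioo_subset).1 hev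
  refine ⟨min δ η / 2, half_pos (lt_min hδ hη), ?_, fun ε hε hεδ μ _ hμ => ?_⟩
  · linarith [min_le_right δ η, lt_min (mem_Ioi.1 hδ) hη]
  · obtain ⟨⟨⟨e1, e2⟩, e3, e4⟩, e5⟩ := hδsub ⟨hε, by
      linarith [min_le_left δ η, lt_min (mem_Ioi.1 hδ) hη]⟩
    obtain ⟨ρ, hρ, hmain⟩ := hC.exists_strict_convexity hF (mem_chart_source _ x) hε
      (le_of_eq_of_le (by ring) e1.le) (le_of_eq_of_le (by ring) e2.le)
      (le_of_eq_of_le (by ring) e3.le) (le_of_eq_of_le (by ring) e4.le) e5.le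
    exact ⟨ρ, hρ, fun a c _ hc _ t₀ ht₀ hS htan t ht hvt =>
      hmain μ hμ.le 0 a c hc t₀ ht₀ hS htan t ht hvt⟩
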